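/- Complex manifolds are finite dimensional, Hausdorff and second countable (not necessarily connected). A \emph{special pair} is a pair of compact topological discs $D\subset D'\subset\mathbb C$ with piecewise smooth boundaries such that $D'$ is obtained from $D$ by attaching the disc $\overline{D'\setminus D}$ along an arc of $bD$. Let $\mathbb B^N$ be the open unit ball of $\mathbb C^N$. A \emph{holomorphic spray} $D\times \mathbb B^N\to V$ is a holomorphic map $O\times\mathbb B^N\to V$ for some open neighbourhood $O$ of $D$; a holomorphic spray $D'\times r\overline{\mathbb B}^N\to X$ is a holomorphic map to $X$ from an open neighbourhood of $D'\times r\overline{\mathbb B}^N$ in $\mathbb C\times\mathbb C^N$. A complex manifold $X$ is an \emph{LSAP manifold} (has the local spray approximation property) if every point $x\in X$ has a neighbourhood $V\subset X$ such that for every special pair $D\subset D'$, every $N$ and every holomorphic spray $F:D\times\mathbb B^N\to V$ there is a number $r\in(0,1)$ such that $F$ can be approximated, uniformly on $D\times r\overline{\mathbb B}^N$ and arbitrarily closely (with respect to any distance function on $X$ inducing the manifold topology), by holomorphic sprays $D'\times r\overline{\mathbb B}^N\to X$. A complex manifold $X$ is \emph{strongly dominable by LSAP manifolds} if for every $x\in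 X$ there are an LSAP manifold $Y$, a holomorphic map $h:Y\to X$ and a point $y\in Y$ such that $h(y)=x$ and $dh_y:T_yY\to T_xX$ is surjective. A holomorphic map $h:X\to Y$ of complex manifolds is an \emph{Oka map} if it is a Serre fibration and has the parametric Oka property with approximation and interpolation: given a Stein manifold $S$, a compact $\mathscr O(S)$-convex set $K\subset S$, a closed complex subvariety $S'\subset S$, compact sets $P_0\subset P$ in a Euclidean space $\mathbb R^m$, and a continuous map $f:P\times S\to X$ such that $h\circ f(p,\cdot)$ is holomorphic on $S$ for all $p\in P$, $f(p,\cdot)$ is holomorphic on $S$ for all $p\in P_0$, and for all $p\in P$ the map $f(p,\cdot)$ is holomorphic on a neighbourhood of $K$ independent of $p$ and $f(p,\cdot)|_{S'}$ is holomorphic, there is a homotopy $f_t:P\times S\to X$, $t\in[0,1]$, with $f_0=f$ and $h\circ f_t=h\circ f$, which is fixed on $(P_0\times S)\cup(P\times S')$, such that the maps $f_t(p,\cdot)$ are holomorphic on a neighbourhood of $K$ independent of $p$ and $t$, $f_t$ is as close as desired to $f$ uniformly on $P\times K$ and in $t$, and $f_1(p,\cdot)$ is holomorphic on $S$ for every $p\in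 P$. \textbf{Proposition.} Let $X$ and $Y$ be complex manifolds. (i) If $X$ is strongly dominable by LSAP manifolds, then $X$ is an LSAP manifold. In particular, if $Z$ is an LSAP manifold and $Z\to X$ is a surjective holomorphic submersion, then $X$ is an LSAP manifold. (ii) If $h:X\to Y$ is a surjective Oka map and $Y$ is an LSAP manifold, then $X$ is an LSAP manifold. (iii) LSAP is a Hausdorff-local property: if $X$ is covered by open subsets (in the manifold topology), each of which is an LSAP manifold, then $X$ is an LSAP manifold. -/

import Mathlib

open Set Topology
open scoped Manifold ContDiff unitInterval

universe u₁ u₂ u₃ v₁ v₂ v₃ w w'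

/-!  Discs in the plane. -/

/-- A piecewise smooth Jordan curve in the plane: the image of a simple closed curve that is
`C^∞` with nowhere vanishing derivative on each interval of a finite subdivision. -/
def IsPiecewiseSmoothJordanCurve (C : Set ℂ) : Prop :=
  ∃ γ : ℝ → ℂ, ContinuousOn γ (Icc 0 1) ∧ γ 0 = γ 1 ∧ InjOn γ (Ico 0 1) ∧ γ '' Icc 0 1 = C ∧
    ∃ (k : ℕ) (t : Fin (k + 1) → ℝ), StrictMono t ∧ t 0 = 0 ∧ t (Fin.last k) = 1 ∧
      ∀ i : Fin k,
        ContDiffOn ℝ ∞ γ (Icc (t i.castSucc) (t i.succ)) ∧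
        ∀ s ∈ Icc (t i.castSucc) (t i.succ),
          derivWithin γ (Icc (t i.castSucc) (t i.succ)) s ≠ 0

/-- A compact topological disc in the plane with piecewise smooth boundary. -/
def IsPiecewiseSmoothDisc (D : Set ℂ) : Prop :=
  Nonempty (Metric.closedBall (0 : ℂ) 1 ≃ₜ D) ∧ IsPiecewiseSmoothJordanCurve (frontier D)

/-- A special pair of discs `D ⊆ D'`: both are compact discs with piecewise smooth boundaries,
and `D'` is obtained from `D` by attaching a disc `closure (D' \ D)` along an arc of the boundary
of `D`. The attached disc is parametrized by the square `[0,1] × [0,1]`, with the arc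
corresponding to the side `{0} × [0,1]`. -/
def IsSpecialPair (D D' : Set ℂ) : Prop :=
  IsPiecewiseSmoothDisc D ∧ IsPiecewiseSmoothDisc D' ∧ D ⊆ D' ∧
    ∃ e : I × I → ℂ, IsEmbedding e ∧ range e = closure (D' \ D) ∧
      e '' {q | q.1 = 0} = D ∩ closure (D' \ D) ∧
      D ∩ closure (D' \ D) ⊆ frontier D

/-!  The local spray approximation property. Holomorphic maps are the maps of class `C^ω`
between complex manifolds. -/

/-- The metric `d` induces the given topology. -/
def IsCompatibleMetric {X : Type*} [τ : TopologicalSpace X] (d : MetricSpace X) : Prop :=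
  d.toPseudoMetricSpace.toUniformSpace.toTopologicalSpace = τ

section LSAP

variable (E : Type*) [NormedAddCommGroup E] [NormedSpace ℂ E]
variable {X : Type*} [TopologicalSpace X] [ChartedSpace E X]

/-- `F` is a holomorphic spray of maps `D → V` with parameter in the open unit ball of `ℂ^N`;
it is defined over an unspecified open neighbourhood `O` of the disc `D`. -/
def IsSprayInto (D : Set ℂ) (N : ℕ) (V : Set X)
    (F : ℂ × EuclideanSpace ℂ (Fin N) → X) : Prop :=
  ∃ O : Set ℂ, IsOpen O ∧ D ⊆ O ∧
    ContMDiffOn 𝓘(ℂ, ℂ × EuclideanSpace ℂ (Fin N)) 𝓘(ℂ, E) ω F (O ×ˢ Metric.ball 0 1) ∧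
    MapsTo F (O ×ˢ Metric.ball 0 1) V

/-- `G` is a holomorphic spray over `D'` with parameter in the closed ball of radius `r` in
`ℂ^N`: it is holomorphic on an open neighbourhood of the product of `D'` with this ball. -/
def IsSprayOnClosedBall (D' : Set ℂ) (N : ℕ) (r : ℝ)
    (G : ℂ × EuclideanSpace ℂ (Fin N) → X) : Prop :=
  ∃ Ω : Set (ℂ × EuclideanSpace ℂ (Fin N)), IsOpen Ω ∧ D' ×ˢ Metric.closedBall 0 r ⊆ Ω ∧
    ContMDiffOn 𝓘(ℂ, ℂ × EuclideanSpace ℂ (Fin N)) 𝓘(ℂ, E) ω G Ω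

/-- The local spray approximation property at the point `x`. -/
def LSAPAt (x : X) : Prop :=
  ∃ V ∈ 𝓝 x, ∀ (D D' : Set ℂ), IsSpecialPair D D' →
    ∀ (N : ℕ) (F : ℂ × EuclideanSpace ℂ (Fin N) → X), IsSprayInto E D N V F →
      ∃ r : ℝ, 0 < r ∧ r < 1 ∧
        ∀ d : MetricSpace X, IsCompatibleMetric d → ∀ ε : ℝ, 0 < ε →
          ∃ G : ℂ × EuclideanSpace ℂ (Fin N) → X, IsSprayOnClosedBall E D' N r G ∧
            ∀ q ∈ D ×ˢ Metric.closedBall (0 : EuclideanSpace ℂ (Fin N)) r,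
              d.dist (F q) (G q) < ε

variable (X) in
/-- The manifold `X` (modelled on `E`) is an LSAP manifold. -/
def LSAP : Prop := ∀ x : X, LSAPAt E x

end LSAP

/-- `X` is strongly dominable by LSAP manifolds: for every point `x` of `X` there are a complex
manifold `Y` with LSAP, a holomorphic map `h : Y → X` and a point `y` with `h y = x` at which `h`
is a submersion. -/
def StronglyDominableByLSAP.{u, u', v, v'} (E : Type u) [NormedAddCommGroup E] [NormedSpace ℂ E]
    (X : Type u') [TopologicalSpace X] [ChartedSpace E X] : Prop :=
  ∀ x : X, ∃ (M : Type v) (_ : NormedAddCommGroup M) (_ : NormedSpace ℂ M)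
    (_ : FiniteDimensional ℂ M) (Y : Type v') (_ : TopologicalSpace Y) (_ : T2Space Y)
    (_ : SecondCountableTopology Y) (_ : ChartedSpace M Y) (_ : IsManifold 𝓘(ℂ, M) ω Y)
    (h : Y → X) (y : Y),
      LSAP M Y ∧ ContMDiff 𝓘(ℂ, M) 𝓘(ℂ, E) ω h ∧ h y = x ∧
        Function.Surjective (mfderiv 𝓘(ℂ, M) 𝓘(ℂ, E) h y)

/-!  Stein manifolds and Oka maps. -/

section Stein

variable (E : Type*) [NormedAddCommGroup E] [NormedSpace ℂ E]
variable {S : Type*} [TopologicalSpace S] [ChartedSpace E S]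

/-- The holomorphically convex hull of `K` in `S`. -/
def holomorphicHull (K : Set S) : Set S :=
  {s | ∀ f : S → ℂ, ContMDiff 𝓘(ℂ, E) 𝓘(ℂ, ℂ) ω f →
    ∀ c : ℝ, (∀ z ∈ K, ‖f z‖ ≤ c) → ‖f s‖ ≤ c}

variable (S) in
/-- A complex manifold is Stein if it is holomorphically convex and its points are separated by
holomorphic functions. -/
def IsSteinManifold : Prop :=
  (∀ K : Set S, IsCompact K → IsCompact (holomorphicHull E K)) ∧
  ∀ x y : S, x ≠ y → ∃ f : S → ℂ, ContMDiff 𝓘(ℂ, E) 𝓘(ℂ, ℂ) ω f ∧ f x ≠ f y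

/-- A closed complex subvariety: locally the set of common zeros of finitely many holomorphic
functions. -/
def IsClosedSubvariety (A : Set S) : Prop :=
  IsClosed A ∧ ∀ s ∈ A, ∃ W : Set S, IsOpen W ∧ s ∈ W ∧
    ∃ (k : ℕ) (f : Fin k → S → ℂ), (∀ i, ContMDiffOn 𝓘(ℂ, E) 𝓘(ℂ, ℂ) ω (f i) W) ∧
      A ∩ W = {z ∈ W | ∀ i, f i z = 0}

/-- The restriction of `f` to the subvariety `A` is holomorphic: locally it extends to a
holomorphic map on an open subset of the ambient manifold. -/
def IsHolomorphicOnSubvariety (E' : Type*) [NormedAddCommGroup E'] [NormedSpace ℂ E']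
    {X : Type*} [TopologicalSpace X] [ChartedSpace E' X] (f : S → X) (A : Set S) : Prop :=
  ∀ s ∈ A, ∃ (W : Set S) (φ : S → X), IsOpen W ∧ s ∈ W ∧
    ContMDiffOn 𝓘(ℂ, E) 𝓘(ℂ, E') ω φ W ∧ EqOn φ f (A ∩ W)

end Stein

/-- A Serre fibration: a continuous map with the homotopy lifting property for all cubes. -/
def IsSerreFibration {X Y : Type*} [TopologicalSpace X] [TopologicalSpace Y] (h : X → Y) : Prop :=
  Continuous h ∧ ∀ (n : ℕ) (H : (Fin n → I) × I → Y) (f : (Fin n → I) → X),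
    Continuous H → Continuous f → (∀ a, h (f a) = H (a, 0)) →
      ∃ L : (Fin n → I) × I → X, Continuous L ∧ (∀ q, h (L q) = H q) ∧ ∀ a, L (a, 0) = f a

section Oka

variable (E₁ : Type*) [NormedAddCommGroup E₁] [NormedSpace ℂ E₁]
variable (E₂ : Type*) [NormedAddCommGroup E₂] [NormedSpace ℂ E₂]
variable {X : Type*} [TopologicalSpace X] [ChartedSpace E₁ X]
variable {Y : Type*} [TopologicalSpace Y] [ChartedSpace E₂ Y]

/-- The parametric Oka property with approximation and interpolation for the map `h : X → Y`.
Here `S` is a Stein manifold, `K` a compact `𝒪(S)`-convex subset, `S'` a closed complex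
subvariety of `S`, and `P₀ ⊆ P` are compact sets in a Euclidean space. Let `f p`, `p ∈ P`, be a
continuous family of maps `S → X` such that `h ∘ f p` is holomorphic for all `p ∈ P`, `f p` is
holomorphic for `p ∈ P₀`, and all `f p` are holomorphic on a fixed neighbourhood of `K` and
on `S'`. Then there are homotopies `Φ t p`, `t ∈ [0,1]`, of liftings of `h ∘ f p` starting with
`f p`, fixed for `p ∈ P₀` and on `S'`, holomorphic on a neighbourhood of `K` and arbitrarily
close to `f p` on `K`, and ending with holomorphic maps `S → X`. -/
def HasPOPAI (h : X → Y) : Prop :=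
  ∀ (M : Type) [NormedAddCommGroup M] [NormedSpace ℂ M] [FiniteDimensional ℂ M]
    (S : Type) [TopologicalSpace S] [T2Space S] [SecondCountableTopology S] [ChartedSpace M S]
    [IsManifold 𝓘(ℂ, M) ω S], IsSteinManifold M S →
  ∀ (K S' : Set S), IsCompact K → holomorphicHull M K = K → IsClosedSubvariety M S' →
  ∀ (m : ℕ) (P P₀ : Set (EuclideanSpace ℝ (Fin m))), IsCompact P → IsCompact P₀ → P₀ ⊆ P →
  ∀ f : P → S → X, Continuous (Function.uncurry f) →
    (∀ p, ContMDiff 𝓘(ℂ, M) 𝓘(ℂ, E₂) ω (fun s => h (f p s))) →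
    (∀ p : P, (p : EuclideanSpace ℝ (Fin m)) ∈ P₀ → ContMDiff 𝓘(ℂ, M) 𝓘(ℂ, E₁) ω (f p)) →
    (∃ U : Set S, IsOpen U ∧ K ⊆ U ∧ ∀ p, ContMDiffOn 𝓘(ℂ, M) 𝓘(ℂ, E₁) ω (f p) U) →
    (∀ p, IsHolomorphicOnSubvariety M E₁ (f p) S') →
  ∀ d : MetricSpace X, IsCompatibleMetric d → ∀ ε : ℝ, 0 < ε →
    ∃ Φ : I → P → S → X,
      Continuous (fun q : I × P × S => Φ q.1 q.2.1 q.2.2) ∧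
      (∀ p s, Φ 0 p s = f p s) ∧
      (∀ t p s, h (Φ t p s) = h (f p s)) ∧
      (∀ (t : I) (p : P) (s : S), (p : EuclideanSpace ℝ (Fin m)) ∈ P₀ ∨ s ∈ S' → Φ t p s = f p s) ∧
      (∃ U : Set S, IsOpen U ∧ K ⊆ U ∧
        ∀ t p, ContMDiffOn 𝓘(ℂ, M) 𝓘(ℂ, E₁) ω (Φ t p) U) ∧
      (∀ t p, ∀ s ∈ K, d.dist (f p s) (Φ t p s) < ε) ∧
      ∀ p, ContMDiff 𝓘(ℂ, M) 𝓘(ℂ, E₁) ω (Φ 1 p)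

/-- An Oka map: a holomorphic map that is a Serre fibration and enjoys the parametric Oka
property with approximation and interpolation. -/
def IsOkaMap (h : X → Y) : Prop :=
  ContMDiff 𝓘(ℂ, E₁) 𝓘(ℂ, E₂) ω h ∧ IsSerreFibration h ∧ HasPOPAI E₁ E₂ h

end Oka

/-! Descent along a map `h` that is a submersion at a point: `h` has a holomorphic local section
there. A spray with values near the image point is lifted by the section, approximated upstairs and
pushed down again by `h`; closeness survives because everything happens near a compact set. This
gives (i) and the statement on submersions (`LSAPAt.of_submersion`). In (iii) an approximation found
inside an open subset is already one in `X` (`LSAPAt.of_opens`).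

For (ii), an Oka map is first shown to be a submersion: the Serre property lifts an inverse chart of
`Y` continuously through a given point, and the Oka property with interpolation makes the lift
holomorphic (`IsOkaMap.surjective_mfderiv`). Near `x` there is then a holomorphic family `Ψ` of
projections to the fibres of `h`. Given a spray `F` near `x`, the spray `h ∘ F` is approximated by a
spray `G` over `D'`, and `Ψ (G, F)` is a holomorphic lifting of `G` near `D`, close to `F`. As `D'`
deforms onto `D`, the homotopy lifting property extends it to a continuous lifting over a
neighbourhood of `D'`, unchanged near `D` (`IsSerreFibration.exists_extension`). The Oka property
deforms this to a holomorphic lifting, still close to `F` over `D` (`IsOkaMap.lsapAt`).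

The last step needs `D` times a closed ball to be holomorphically convex. This holds because a disc
is a retract of the plane, so its complement has no bounded component, and hence it is polynomially
convex. -/

/-! ### Polynomial convexity of plane discs -/

/-- A disc is a retract of the plane. -/
theorem IsPiecewiseSmoothDisc.exists_retraction {D : Set ℂ} (hD : IsPiecewiseSmoothDisc D) :
    ∃ R : ℂ → ℂ, Continuous R ∧ (∀ z, R z ∈ D) ∧ ∀ z ∈ D, R z = z := by
  obtain ⟨⟨φ⟩, -⟩ := hD
  have : CompactSpace D := φ.compactSpace
  have hDc : IsClosed D := (isCompact_iff_compactSpace.mpr this).isClosed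
  obtain ⟨g, hg⟩ := ContinuousMap.exists_restrict_eq hDc (⟨φ.symm, φ.symm.continuous⟩ : C(D, _))
  refine ⟨fun z => φ (g z), by fun_prop, fun z => (φ (g z)).2, fun z hz => ?_⟩
  have h := congrArg (fun f : C(D, Metric.closedBall (0 : ℂ) 1) => f ⟨z, hz⟩) hg
  simp only [ContinuousMap.restrict_apply, ContinuousMap.coe_mk] at h
  change (φ (g z) : ℂ) = z
  rw [h]
  simp

theorem IsPiecewiseSmoothDisc.isCompact {D : Set ℂ} (hD : IsPiecewiseSmoothDisc D) :
    IsCompact D := by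
  obtain ⟨⟨φ⟩, -⟩ := hD
  exact isCompact_iff_compactSpace.mpr φ.compactSpace

/-- A continuous self-map of the plane that is the identity near infinity is onto. -/
theorem surjective_of_continuous_eq_id_of_norm_gt {ψ : ℂ → ℂ} (hψ : Continuous ψ) (ρ : ℝ)
    (hρ : ∀ z, ρ < ‖z‖ → ψ z = z) : Function.Surjective ψ := by
  by_contra hns
  simp only [Function.Surjective, not_forall, not_exists] at hns
  obtain ⟨c, hc⟩ := hns
  -- If `c` were omitted, `ψ - c` would have a continuous logarithm `k` on the plane, although it
  -- winds once around `0` along a large circle about `c`, where `ψ` is the identity.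
  obtain ⟨k, hk, hke⟩ := Complex.exists_continuousOn_eqOn_exp_comp (U := (univ : Set ℂ))
    (g := fun z => ψ z - c) (by
      have : ContractibleSpace (univ : Set ℂ) := convex_univ.contractibleSpace ⟨0, mem_univ 0⟩
      exact SimplyConnectedSpace.ofContractible _) isOpen_univ
    (by fun_prop) (by
      rintro ⟨z, -, hz⟩
      exact hc z (sub_eq_zero.mp hz))
  rw [continuousOn_univ] at hk
  set s : ℝ := |ρ| + ‖c‖ + 1 with hs
  have hs0 : 0 < s := by positivity
  let p : ℝ → ℂ := fun θ => c + s * Complex.exp (θ * Complex.I)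
  have hp : Continuous p := by fun_prop
  have hψp : ∀ θ, ψ (p θ) = p θ := fun θ => by
    apply hρ
    have h1 : ‖(s : ℂ) * Complex.exp (θ * Complex.I)‖ = s := by
      rw [norm_mul, Complex.norm_exp_ofReal_mul_I, mul_one, Complex.norm_real, Real.norm_eq_abs,
        abs_of_pos hs0]
    have h2 := norm_sub_le (p θ) c
    have h3 : p θ - c = s * Complex.exp (θ * Complex.I) := by simp [p]
    rw [h3, h1] at h2
    have := le_abs_self ρ
    linarith
  have hkp : ∀ θ, Complex.exp (k (p θ) - θ * Complex.I) = s := fun θ => by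
    have h := hke (mem_univ (p θ))
    simp only [Function.comp_apply, hψp] at h
    rw [Complex.exp_sub, h]
    simp [p]
  have hint : ∀ θ : ℝ, ∃ n : ℤ, ((k (p θ) - θ * Complex.I) - k (p 0)).im = n * (2 * Real.pi) := by
    intro θ
    have h0 := hkp 0
    simp only [Complex.ofReal_zero, zero_mul, sub_zero] at h0
    obtain ⟨n, hn⟩ := Complex.exp_eq_exp_iff_exists_int.mp ((hkp θ).trans h0.symm)
    refine ⟨n, ?_⟩
    rw [hn]
    simp
  have hcont : ContinuousOn (fun θ : ℝ => ((k (p θ) - θ * Complex.I) - k (p 0)).im)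
      (Icc 0 (2 * Real.pi)) := by fun_prop
  have h2π : p (2 * Real.pi) = p 0 := by simp [p]
  -- The function goes from `0` to `-2π` but takes values only in `2πℤ`, so it cannot pass through
  -- `-π`.
  have hmem : -Real.pi ∈ Icc ((fun θ : ℝ => ((k (p θ) - θ * Complex.I) - k (p 0)).im) (2 * Real.pi))
      ((fun θ : ℝ => ((k (p θ) - θ * Complex.I) - k (p 0)).im) 0) := by
    simp [h2π, Real.pi_pos.le]
    linarith [Real.pi_pos]
  obtain ⟨θ, -, hθ⟩ := intermediate_value_Icc' (by positivity) hcont hmem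
  obtain ⟨n, hn⟩ := hint θ
  simp only at hθ
  rw [hθ] at hn
  have h3 : (2 * n + 1 : ℝ) = 0 := by
    have := Real.pi_pos
    have h4 : (2 * n + 1 : ℝ) * Real.pi = 0 := by linarith
    exact (mul_eq_zero.mp h4).resolve_right this.ne'
  have h4 : (2 * n + 1 : ℤ) = 0 := by exact_mod_cast h3
  omega

/-- The complement of a compact retract of the plane has no bounded components. -/
theorem not_isBounded_connectedComponentIn_compl_of_retract {D : Set ℂ} (hD : IsCompact D)
    {R : ℂ → ℂ} (hR : Continuous R) (hRD : ∀ z, R z ∈ D) (hRid : ∀ z ∈ D, R z = z)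
    {c : ℂ} (hc : c ∉ D) : ¬ Bornology.IsBounded (connectedComponentIn Dᶜ c) := by
  classical
  intro hb
  set C := connectedComponentIn Dᶜ c with hC
  have hCo : IsOpen C := hD.isClosed.isOpen_compl.connectedComponentIn
  have hcC : c ∈ C := mem_connectedComponentIn hc
  have hfr : frontier C ⊆ D := by
    intro z hz
    by_contra hzD
    have hCc : IsClosed (((↑) : (Dᶜ : Set ℂ) → ℂ) ⁻¹' C) := by
      have := isClosed_connectedComponent (x := (⟨c, hc⟩ : (Dᶜ : Set ℂ)))
      rw [hC, connectedComponentIn_eq_image hc, preimage_image_eq _ Subtype.val_injective]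
      exact this
    rw [hCo.frontier_eq] at hz
    obtain ⟨t, ht, htC⟩ := isClosed_induced_iff.mp hCc
    have hCt : C ⊆ t := fun w hw => by
      have : (⟨w, connectedComponentIn_subset _ _ hw⟩ : (Dᶜ : Set ℂ)) ∈
        ((↑) : (Dᶜ : Set ℂ) → ℂ) ⁻¹' t := by rw [htC]; exact hw
      exact this
    have hzt : (⟨z, hzD⟩ : (Dᶜ : Set ℂ)) ∈ ((↑) : (Dᶜ : Set ℂ) → ℂ) ⁻¹' t :=
      (ht.closure_subset_iff.mpr hCt) hz.1
    rw [htC] at hzt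
    exact hz.2 hzt
  obtain ⟨ρ, hρ⟩ := hb.exists_norm_le
  -- `R` on `C` and the identity elsewhere agree on the frontier of `C`, which lies in `D`. If `C`
  -- is bounded, the glued map is the identity near infinity and yet omits `c`.
  have hcont : Continuous (fun z => if z ∈ C then R z else z) := by
    apply Continuous.if _ hR continuous_id
    intro z hz
    exact hRid z (hfr hz)
  obtain ⟨z, hz⟩ := surjective_of_continuous_eq_id_of_norm_gt hcont ρ
    (fun z hz => if_neg fun h => (hρ z h).not_gt hz) c
  by_cases h : z ∈ C
  · simp only [h, if_true] at hz
    exact hc (hz ▸ hRD z)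
  · simp only [h, if_false] at hz
    exact h (hz ▸ hcC)

/-- A compact plane set whose complement has no bounded components is polynomially convex. -/
theorem exists_polynomial_eval_eq_one_norm_lt {D : Set ℂ} (hD : IsCompact D) {c : ℂ}
    (hc : ¬ Bornology.IsBounded (connectedComponentIn Dᶜ c)) :
    ∃ p : Polynomial ℂ, p.eval c = 1 ∧ ∀ z ∈ D, ‖p.eval z‖ ≤ 1 / 2 := by
  have : CompactSpace D := isCompact_iff_compactSpace.mp hD
  let A : Subalgebra ℂ C(D, ℂ) := (polynomialFunctions D).topologicalClosure
  have hA : IsClosed (A : Set C(D, ℂ)) := Subalgebra.isClosed_topologicalClosure _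
  let ζ : A := ⟨Polynomial.toContinuousMapOnAlgHom D Polynomial.X,
    Subalgebra.le_topologicalClosure _ ⟨Polynomial.X, by simp, rfl⟩⟩
  have hspec : spectrum ℂ (ζ : C(D, ℂ)) = D := by
    rw [ContinuousMap.spectrum_eq_range]
    ext z
    simp [ζ]
  -- Passing from `C(D, ℂ)` to the closed subalgebra `A` can only add to the spectrum points in
  -- bounded components of its complement.
  have hns : c ∉ spectrum ℂ ζ := fun h => by
    have := Subalgebra.spectrum_isBounded_connectedComponentIn A ζ h
    rw [hspec] at this
    exact hc this
  rw [spectrum.notMem_iff] at hns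
  obtain ⟨u, hu⟩ := hns.exists_right_inv
  have hu' : ∀ z : D, (c - z) * (u : C(D, ℂ)) z = 1 := fun z => by
    have := congrArg (fun f : A => (f : C(D, ℂ)) z) hu
    simpa [ζ] using this
  obtain ⟨M, hM⟩ : ∃ M : ℝ, 0 < M ∧ ∀ z ∈ D, ‖c - z‖ ≤ M := by
    obtain ⟨M, hM⟩ := (hD.image (f := fun z => c - z) (by fun_prop)).isBounded.exists_norm_le
    exact ⟨max M 1, by positivity, fun z hz => (hM _ (mem_image_of_mem _ hz)).trans (le_max_left _ _)⟩
  have hucl : (u : C(D, ℂ)) ∈ closure (polynomialFunctions D : Set C(D, ℂ)) := by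
    rw [← Subalgebra.topologicalClosure_coe]; exact u.2
  obtain ⟨v, hv, huv⟩ := Metric.mem_closure_iff.mp hucl (1 / (2 * M)) (by have := hM.1; positivity)
  obtain ⟨p, -, rfl⟩ := hv
  -- With `u` the inverse of `c - ζ`, this polynomial equals `(c - z) * (u z - p z)` on `D`; the
  -- factors are at most `M` and `1 / (2 * M)`.
  refine ⟨1 - (Polynomial.C c - Polynomial.X) * p, by simp, fun z hz => ?_⟩
  have h1 : ‖(u : C(D, ℂ)) ⟨z, hz⟩ - p.eval z‖ ≤ 1 / (2 * M) := by
    have := (ContinuousMap.dist_apply_le_dist ⟨z, hz⟩).trans huv.le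
    rw [dist_eq_norm] at this
    simpa using this
  have h2 : (1 - (Polynomial.C c - Polynomial.X) * p).eval z =
      (c - z) * ((u : C(D, ℂ)) ⟨z, hz⟩ - p.eval z) := by
    rw [mul_sub, hu' ⟨z, hz⟩]
    simp
  rw [h2, norm_mul]
  calc _ ≤ M * (1 / (2 * M)) := by
        exact mul_le_mul (hM.2 z hz) h1 (norm_nonneg _) hM.1.le
    _ = 1 / 2 := by have := hM.1; field_simp

theorem IsPiecewiseSmoothDisc.exists_polynomial {D : Set ℂ} (hD : IsPiecewiseSmoothDisc D) {c : ℂ}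
    (hc : c ∉ D) : ∃ p : Polynomial ℂ, p.eval c = 1 ∧ ∀ z ∈ D, ‖p.eval z‖ ≤ 1 / 2 := by
  obtain ⟨R, hR, hRD, hRid⟩ := hD.exists_retraction
  exact exists_polynomial_eval_eq_one_norm_lt hD.isCompact
    (not_isBounded_connectedComponentIn_compl_of_retract hD.isCompact hR hRD hRid hc)

/-! ### Compatible metrics and uniform closeness on compact sets -/

/-- Points close to the graph of a map over a compact set lie in a given neighbourhood of
the graph. -/
theorem IsCompact.exists_forall_dist_lt_mem {X Y : Type*} [TopologicalSpace X]
    [τ : TopologicalSpace Y] (d : MetricSpace Y) (hd : IsCompatibleMetric d) {K : Set X}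
    (hK : IsCompact K) {h : X → Y} (hh : ContinuousOn h K) {W : Set (Y × X)}
    (hW : ∀ x ∈ K, W ∈ 𝓝 (h x, x)) :
    ∃ δ > 0, ∀ x ∈ K, ∀ y, d.dist (h x) y < δ → (y, x) ∈ W := by
  unfold IsCompatibleMetric at hd
  subst hd
  refine hK.induction_on (p := fun K => ∃ δ > 0, ∀ x ∈ K, ∀ y, d.dist (h x) y < δ → (y, x) ∈ W)
    ⟨1, one_pos, by simp⟩ ?_ ?_ ?_
  · rintro s t hst ⟨δ, hδ, H⟩
    exact ⟨δ, hδ, fun x hx => H x (hst hx)⟩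
  · rintro s t ⟨δ, hδ, H⟩ ⟨δ', hδ', H'⟩
    refine ⟨min δ δ', lt_min hδ hδ', ?_⟩
    rintro x (hx | hx) y hy
    · exact H x hx y (hy.trans_le (min_le_left _ _))
    · exact H' x hx y (hy.trans_le (min_le_right _ _))
  · intro x hx
    obtain ⟨V, hV, U, hU, hVU⟩ := mem_nhds_prod_iff.mp (hW x hx)
    obtain ⟨δ, hδ, hball⟩ := Metric.mem_nhds_iff.mp hV
    have h1 : {x' | dist (h x') (h x) < δ / 2} ∈ 𝓝[K] x :=
      (hh x hx).preimage_mem_nhdsWithin (Metric.ball_mem_nhds _ (half_pos hδ))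
    refine ⟨_, Filter.inter_mem h1 (mem_nhdsWithin_of_mem_nhds hU), δ / 2, half_pos hδ, ?_⟩
    rintro x' ⟨hx', hx'U⟩ y hy
    refine hVU ⟨hball ?_, hx'U⟩
    have h2 : dist (h x') y < δ / 2 := hy
    have h3 : dist (h x') (h x) < δ / 2 := hx'
    rw [Metric.mem_ball]
    have := dist_triangle_left y (h x) (h x')
    linarith

theorem IsCompatibleMetric.continuous_dist {X Z : Type*} [τ : TopologicalSpace X]
    {d : MetricSpace X} (hd : IsCompatibleMetric d) [TopologicalSpace Z] {f g : Z → X}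
    {z : Z} (hf : ContinuousAt f z) (hg : ContinuousAt g z) :
    ContinuousAt (fun z => d.dist (f z) (g z)) z := by
  unfold IsCompatibleMetric at hd
  subst hd
  exact hf.dist hg

theorem exists_isCompatibleMetric (E : Type*) [NormedAddCommGroup E] [NormedSpace ℂ E]
    [FiniteDimensional ℂ E] (X : Type*) [TopologicalSpace X] [T2Space X]
    [SecondCountableTopology X] [ChartedSpace E X] :
    ∃ d : MetricSpace X, IsCompatibleMetric d := by
  have : ProperSpace E := FiniteDimensional.proper ℂ E
  have : LocallyCompactSpace X := ChartedSpace.locallyCompactSpace E X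
  have : TopologicalSpace.MetrizableSpace X :=
    TopologicalSpace.metrizableSpace_of_t3_secondCountable X
  exact ⟨TopologicalSpace.metrizableSpaceMetric X, rfl⟩

/-! ### Holomorphic projections onto the fibres of a submersion -/

section Submersion

variable {E : Type*} [NormedAddCommGroup E] [NormedSpace ℂ E] [FiniteDimensional ℂ E]
variable {E₂ : Type*} [NormedAddCommGroup E₂] [NormedSpace ℂ E₂] [FiniteDimensional ℂ E₂]

/-- Near a point where its derivative is onto, a holomorphic map `f` admits a holomorphic family
of projections `x ↦ φ (y, x)` onto its fibres. -/
theorem ContDiffAt.exists_fibre_projection {f : E → E₂} {a : E} (hf : ContDiffAt ℂ ω f a)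
    (hs : Function.Surjective (fderiv ℂ f a)) :
    ∃ φ : E₂ × E → E, ContDiffAt ℂ ω φ (f a, a) ∧ φ (f a, a) = a ∧
      (∀ᶠ q in 𝓝 (f a, a), f (φ q) = q.1) ∧ ∀ᶠ x in 𝓝 a, φ (f x, x) = x := by
  have : CompleteSpace E := FiniteDimensional.complete ℂ E
  have : CompleteSpace E₂ := FiniteDimensional.complete ℂ E₂
  obtain ⟨B', hB'⟩ := (fderiv ℂ f a : E →ₗ[ℂ] E₂).exists_rightInverse_of_surjective
    (LinearMap.range_eq_top.mpr hs)
  let B : E₂ →L[ℂ] E := LinearMap.toContinuousLinearMap B'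
  have hB : ∀ v, fderiv ℂ f a (B v) = v := fun v => by
    exact LinearMap.congr_fun hB' v
  -- The derivative of `Θ` at `(a, 0)` is `(u, v) ↦ (u, f' u + v)`, which is invertible. The local
  -- inverse finds the `v` with `f (x + B v) = y`, and the projection sends `(y, x)` to `x + B v`.
  -- For `y = f x` this gives `v = 0`.
  let Θ : E × E₂ → E × E₂ := fun p => (p.1, f (p.1 + B p.2))
  have hpt : a + B 0 = a := by simp
  have hΘ : ContDiffAt ℂ ω Θ (a, 0) := by
    refine contDiffAt_fst.prodMk ?_
    refine ContDiffAt.comp (g := f) (f := fun p : E × E₂ => p.1 + B p.2) (a, (0 : E₂)) ?_ ?_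
    · simpa using hf
    · exact contDiffAt_fst.add (B.contDiff.contDiffAt.comp _ contDiffAt_snd)
  have hΘ' : HasFDerivAt Θ (((ContinuousLinearEquiv.refl ℂ E).skewProd
      (ContinuousLinearEquiv.refl ℂ E₂) (fderiv ℂ f a) : (E × E₂) ≃L[ℂ] (E × E₂)) :
      (E × E₂) →L[ℂ] (E × E₂)) (a, 0) := by
    have h1 : HasFDerivAt (fun p : E × E₂ => p.1 + B p.2)
        (ContinuousLinearMap.fst ℂ E E₂ + B.comp (ContinuousLinearMap.snd ℂ E E₂)) (a, 0) :=
      (ContinuousLinearMap.fst ℂ E E₂ + B.comp (ContinuousLinearMap.snd ℂ E E₂)).hasFDerivAt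
    have h2 : HasFDerivAt f (fderiv ℂ f a) (a + B 0) := by
      rw [hpt]
      exact (hf.differentiableAt (by simp)).hasFDerivAt
    have h3 := hasFDerivAt_fst (𝕜 := ℂ) (p := (a, (0 : E₂))) |>.prodMk (h2.comp (a, (0 : E₂)) h1)
    refine h3.congr_fderiv ?_
    ext v <;> simp [hB]
  let e := hΘ.toOpenPartialHomeomorph Θ hΘ' (by simp)
  have he : ∀ p, e p = Θ p := fun p => rfl
  have hes : (a, 0) ∈ e.source := hΘ.mem_toOpenPartialHomeomorph_source hΘ' (by simp)
  have hΘa : Θ (a, 0) = (a, f a) := by simp [Θ]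
  have het : (a, f a) ∈ e.target := by
    rw [← hΘa, ← he]; exact e.map_source hes
  have hsymm : ContDiffAt ℂ ω e.symm (a, f a) := by
    have h := hΘ.to_localInverse hΘ' (by simp)
    rw [hΘa] at h
    exact h
  have hswap : ContDiffAt ℂ ω (fun q : E₂ × E => e.symm (q.2, q.1)) (f a, a) :=
    ContDiffAt.comp (g := e.symm) (f := fun q : E₂ × E => (q.2, q.1)) (f a, a) hsymm
      (contDiffAt_snd.prodMk contDiffAt_fst)
  have key : ∀ x, (x, (0 : E₂)) ∈ e.source → e.symm (x, f x) = (x, 0) := fun x hx => by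
    have : e (x, 0) = (x, f x) := by simp [he, Θ]
    rw [← this, e.left_inv hx]
  refine ⟨fun q => (e.symm (q.2, q.1)).1 + B (e.symm (q.2, q.1)).2, ?_, ?_, ?_, ?_⟩
  · exact (contDiffAt_fst.comp _ hswap).add
      (B.contDiff.contDiffAt.comp _ (contDiffAt_snd.comp _ hswap))
  · simp [key a hes]
  · have hc : ContinuousAt (fun q : E₂ × E => (q.2, q.1)) (f a, a) := by fun_prop
    filter_upwards [hc (e.open_target.mem_nhds het)] with q hq
    have h := e.right_inv hq
    rw [he] at h
    exact congrArg Prod.snd h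
  · have hc : ContinuousAt (fun x : E => (x, (0 : E₂))) a := by fun_prop
    filter_upwards [hc (e.open_source.mem_nhds hes)] with x hx
    simp [key x hx]

variable {X : Type*} [TopologicalSpace X] [ChartedSpace E X] [IsManifold 𝓘(ℂ, E) ω X]
variable {Y : Type*} [TopologicalSpace Y] [ChartedSpace E₂ Y]

/-- The vector space case is transported through charts. Near the base point both `h (Ψ q)` and
`q.1` lie in the chart at `h x`, so equality of their coordinates suffices. -/
theorem ContMDiffAt.exists_fibre_projection {h : X → Y} {x : X}
    (hh : ContMDiffAt 𝓘(ℂ, E) 𝓘(ℂ, E₂) ω h x)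
    (hs : Function.Surjective (mfderiv 𝓘(ℂ, E) 𝓘(ℂ, E₂) h x)) :
    ∃ Ψ : Y × X → X, ContMDiffAt (𝓘(ℂ, E₂).prod 𝓘(ℂ, E)) 𝓘(ℂ, E) ω Ψ (h x, x) ∧
      Ψ (h x, x) = x ∧
      (∀ᶠ q in 𝓝 (h x, x), h (Ψ q) = q.1) ∧ ∀ᶠ x' in 𝓝 x, Ψ (h x', x') = x' := by
  set ex := extChartAt 𝓘(ℂ, E) x with hex
  set ey := extChartAt 𝓘(ℂ, E₂) (h x) with hey
  set f : E → E₂ := writtenInExtChartAt 𝓘(ℂ, E) 𝓘(ℂ, E₂) x h with hf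
  have hfx : ∀ z, f z = ey (h (ex.symm z)) := fun z => rfl
  have hfd : ContDiffAt ℂ ω f (ex x) := by
    have := (contMDiffAt_iff.mp hh).2
    rw [ModelWithCorners.range_eq_univ, contDiffWithinAt_univ] at this
    exact this
  have hmd : MDifferentiableAt 𝓘(ℂ, E) 𝓘(ℂ, E₂) h x := hh.mdifferentiableAt (by simp)
  have hfs : Function.Surjective (fderiv ℂ f (ex x)) := by
    rw [hmd.mfderiv, ModelWithCorners.range_eq_univ, fderivWithin_univ] at hs
    exact hs
  have hxx : ex.symm (ex x) = x := extChartAt_to_inv x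
  have hfa : f (ex x) = ey (h x) := by rw [hfx, hxx]
  obtain ⟨φ, hφ, hφa, hφ1, hφ2⟩ := hfd.exists_fibre_projection hfs
  rw [hfa] at hφ hφa hφ1
  let P : Y × X → E₂ × E := fun q => (ey q.1, ex q.2)
  have hP : ContMDiffAt (𝓘(ℂ, E₂).prod 𝓘(ℂ, E)) 𝓘(ℂ, E₂ × E) ω P (h x, x) := by
    refine ContMDiffAt.prodMk_space ?_ ?_
    · exact (contMDiffAt_extChartAt (x := h x)).comp (h x, x) contMDiffAt_fst
    · exact (contMDiffAt_extChartAt (x := x)).comp (h x, x) contMDiffAt_snd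
  have hsymm : ContMDiffAt 𝓘(ℂ, E) 𝓘(ℂ, E) ω ex.symm (ex x) :=
    (contMDiffOn_extChartAt_symm x).contMDiffAt (extChartAt_target_mem_nhds x)
  have hΨ : ContMDiffAt (𝓘(ℂ, E₂).prod 𝓘(ℂ, E)) 𝓘(ℂ, E) ω (fun q => ex.symm (φ (P q)))
      (h x, x) := by
    have h0 : ContMDiffAt 𝓘(ℂ, E) 𝓘(ℂ, E) ω ex.symm (φ (P (h x, x))) := by
      have : φ (P (h x, x)) = ex x := hφa
      rwa [this]
    have h1 : ContMDiffAt 𝓘(ℂ, E₂ × E) 𝓘(ℂ, E) ω φ (P (h x, x)) := hφ.contMDiffAt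
    exact h0.comp (h x, x) (h1.comp (h x, x) hP)
  have hΨx : ex.symm (φ (P (h x, x))) = x := by
    change ex.symm (φ (ey (h x), ex x)) = x
    rw [hφa, hxx]
  refine ⟨fun q => ex.symm (φ (P q)), hΨ, hΨx, ?_, ?_⟩
  · have hc : ContinuousAt (fun q => h (ex.symm (φ (P q)))) (h x, x) := by
      refine ContinuousAt.comp (g := h) (f := fun q => ex.symm (φ (P q))) ?_ hΨ.continuousAt
      rw [hΨx]
      exact hh.continuousAt
    have h1 : ∀ᶠ q : Y × X in 𝓝 (h x, x), h (ex.symm (φ (P q))) ∈ ey.source := by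
      apply hc
      change ey.source ∈ 𝓝 (h (ex.symm (φ (P (h x, x)))))
      rw [hΨx]
      exact extChartAt_source_mem_nhds (h x)
    have h2 : ∀ᶠ q : Y × X in 𝓝 (h x, x), q.1 ∈ ey.source :=
      continuousAt_fst (extChartAt_source_mem_nhds (h x))
    have h3 : ∀ᶠ q : Y × X in 𝓝 (h x, x), f (φ (P q)) = (P q).1 := hP.continuousAt hφ1
    filter_upwards [h1, h2, h3] with q h1 h2 h3
    exact ey.injOn h1 h2 h3
  · have h1 : ∀ᶠ x' in 𝓝 x, φ (f (ex x'), ex x') = ex x' :=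
      (continuousAt_extChartAt x) hφ2
    have h2 : ∀ᶠ x' in 𝓝 x, x' ∈ ex.source := extChartAt_source_mem_nhds x
    filter_upwards [h1, h2] with x' h1 h2
    have h3 : ex.symm (ex x') = x' := ex.left_inv h2
    rw [hfx, h3] at h1
    change ex.symm (φ (ey (h x'), ex x')) = x'
    rw [h1, h3]

end Submersion

/-! ### Descent along submersions and from open subsets -/

section Descent

variable {E : Type*} [NormedAddCommGroup E] [NormedSpace ℂ E]
variable {X : Type*} [TopologicalSpace X] [ChartedSpace E X]

/-- The local spray approximation property descends along holomorphic maps that are submersions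
at the point in question. -/
theorem LSAPAt.of_submersion [FiniteDimensional ℂ E] {M : Type*} [NormedAddCommGroup M] [NormedSpace ℂ M]
    [FiniteDimensional ℂ M] {Z : Type*} [TopologicalSpace Z] [T2Space Z]
    [SecondCountableTopology Z] [ChartedSpace M Z] [IsManifold 𝓘(ℂ, M) ω Z]
    {h : Z → X} {z : Z} (hh : ContMDiff 𝓘(ℂ, M) 𝓘(ℂ, E) ω h)
    (hs : Function.Surjective (mfderiv 𝓘(ℂ, M) 𝓘(ℂ, E) h z)) [IsManifold 𝓘(ℂ, E) ω X]
    (hz : LSAPAt M z) : LSAPAt E (h z) := by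
  obtain ⟨Ψ, hΨ, hΨz, hΨ1, -⟩ := (hh z).exists_fibre_projection hs
  obtain ⟨V, hV, H⟩ := hz
  -- Fixing the second argument of the projection gives a local holomorphic section of `h` through
  -- `z`.
  let s : X → Z := fun x => Ψ (x, z)
  have hsz : s (h z) = z := hΨz
  have hsc : ContMDiffAt 𝓘(ℂ, E) 𝓘(ℂ, M) ω s (h z) :=
    hΨ.comp (h z) (contMDiffAt_id.prodMk contMDiffAt_const)
  have hc : ContinuousAt (fun x : X => (x, z)) (h z) := by fun_prop
  have e1 : ∀ᶠ x in 𝓝 (h z), ContMDiffAt 𝓘(ℂ, E) 𝓘(ℂ, M) ω s x :=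
    (contMDiffAt_iff_contMDiffAt_nhds (by simp)).mp hsc
  have e2 : ∀ᶠ x in 𝓝 (h z), s x ∈ V := hsc.continuousAt (by rwa [hsz])
  have e3 : ∀ᶠ x in 𝓝 (h z), h (s x) = x := hc hΨ1
  refine ⟨_, e1.and (e2.and e3), ?_⟩
  rintro D D' hDD N F ⟨O, hO, hDO, hF, hFV⟩
  have hsF : ContMDiffOn 𝓘(ℂ, ℂ × EuclideanSpace ℂ (Fin N)) 𝓘(ℂ, M) ω (fun q => s (F q))
      (O ×ˢ Metric.ball 0 1) := fun q hq =>
    (hFV hq).1.comp_contMDiffWithinAt q (hF q hq)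
  obtain ⟨r, hr0, hr1, hr⟩ := H D D' hDD N (fun q => s (F q))
    ⟨O, hO, hDO, hsF, fun q hq => (hFV hq).2.1⟩
  refine ⟨r, hr0, hr1, fun d hd ε hε => ?_⟩
  obtain ⟨dZ, hdZ⟩ := exists_isCompatibleMetric M Z
  have hsub : D ×ˢ Metric.closedBall (0 : EuclideanSpace ℂ (Fin N)) r ⊆ O ×ˢ Metric.ball 0 1 :=
    prod_mono hDO (Metric.closedBall_subset_ball hr1)
  have hK : IsCompact ((fun q => s (F q)) ''
      (D ×ˢ Metric.closedBall (0 : EuclideanSpace ℂ (Fin N)) r)) :=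
    (hDD.1.isCompact.prod (isCompact_closedBall 0 r)).image_of_continuousOn
      (hsF.continuousOn.mono hsub)
  -- Uniform continuity of `h` at the points of a compact set: being `δ`-close to such a point in
  -- `Z` forces `ε`-closeness of the images.
  obtain ⟨δ, hδ, Hδ⟩ := hK.exists_forall_dist_lt_mem dZ hdZ (h := id)
    continuousOn_id (W := {p | d.dist (h p.2) (h p.1) < ε}) (by
      intro k _
      have hcont : ContinuousAt (fun p : Z × Z => d.dist (h p.2) (h p.1)) (k, k) :=
        hd.continuous_dist (hh.continuous.continuousAt.comp continuousAt_snd)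
          (hh.continuous.continuousAt.comp continuousAt_fst)
      have hself : d.dist (h k) (h k) = 0 := d.dist_self _
      exact hcont (Iio_mem_nhds (by change d.dist (h k) (h k) < ε; rw [hself]; exact hε)))
  obtain ⟨G, ⟨Ω, hΩ, hDΩ, hG⟩, hGd⟩ := hr dZ hdZ δ hδ
  refine ⟨fun q => h (G q), ⟨Ω, hΩ, hDΩ, hh.comp_contMDiffOn hG⟩, fun q hq => ?_⟩
  have h1 := Hδ _ (mem_image_of_mem _ hq) (G q) (hGd q hq)
  have h2 : h (s (F q)) = F q := (hFV (hsub hq)).2.2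
  simpa [h2] using h1

/-- The local spray approximation property can be checked on an open neighbourhood. -/
theorem LSAPAt.of_opens {U : TopologicalSpace.Opens X} {x : U} (hx : LSAPAt E x) :
    LSAPAt E (x : X) := by
  classical
  obtain ⟨V, hV, H⟩ := hx
  refine ⟨Subtype.val '' V, U.isOpenEmbedding'.image_mem_nhds.mpr hV, ?_⟩
  rintro D D' hDD N F ⟨O, hO, hDO, hF, hFV⟩
  let F' : ℂ × EuclideanSpace ℂ (Fin N) → U := fun q => if h : F q ∈ U then ⟨F q, h⟩ else x
  have hF'F : ∀ q ∈ O ×ˢ Metric.ball (0 : EuclideanSpace ℂ (Fin N)) 1, (F' q : X) = F q := by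
    intro q hq
    obtain ⟨v, -, hv⟩ := hFV hq
    have : F q ∈ U := hv ▸ v.2
    simp [F', this]
  have hF' : ContMDiffOn 𝓘(ℂ, ℂ × EuclideanSpace ℂ (Fin N)) 𝓘(ℂ, E) ω F'
      (O ×ˢ Metric.ball 0 1) := by
    intro q hq
    have h1 : ContMDiffWithinAt 𝓘(ℂ, ℂ × EuclideanSpace ℂ (Fin N)) 𝓘(ℂ, E) ω
        (Subtype.val ∘ F') (O ×ˢ Metric.ball 0 1) q := (hF q hq).congr hF'F (hF'F q hq)
    exact (ChartedSpace.liftPropWithinAt_subtypeVal_comp_iff ..).mp h1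
  obtain ⟨r, hr0, hr1, hr⟩ := H D D' hDD N F' ⟨O, hO, hDO, hF', fun q hq => by
    obtain ⟨v, hv, hvq⟩ := hFV hq
    have : F' q = v := Subtype.ext ((hF'F q hq).trans hvq.symm)
    rwa [this]⟩
  refine ⟨r, hr0, hr1, fun d hd ε hε => ?_⟩
  obtain ⟨G, ⟨Ω, hΩ, hDΩ, hG⟩, hGd⟩ := hr (MetricSpace.induced Subtype.val Subtype.val_injective d)
    (by
      have h1 : (MetricSpace.induced (Subtype.val : U → X) Subtype.val_injective
        d).toPseudoMetricSpace.toUniformSpace.toTopologicalSpace =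
        d.toPseudoMetricSpace.toUniformSpace.toTopologicalSpace.induced Subtype.val := rfl
      unfold IsCompatibleMetric at hd ⊢
      rw [h1, hd]
      rfl) ε hε
  refine ⟨fun q => (G q : X), ⟨Ω, hΩ, hDΩ, contMDiff_subtype_val.comp_contMDiffOn hG⟩,
    fun q hq => ?_⟩
  have h1 : d.dist (F' q : X) (G q : X) < ε := hGd q hq
  rwa [hF'F q (prod_mono hDO (Metric.closedBall_subset_ball hr1) hq)] at h1

end Descent

/-! ### Stein products of a plane domain and a ball -/

section Products

variable {N : ℕ} {O : Set ℂ} {ρ : ℝ}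
  {S : TopologicalSpace.Opens (ℂ × EuclideanSpace ℂ (Fin N))}

theorem contMDiff_opens_of_contDiffAt {M F : Type*} [NormedAddCommGroup M] [NormedSpace ℂ M]
    [NormedAddCommGroup F] [NormedSpace ℂ F] {S : TopologicalSpace.Opens M} {g : M → F}
    (hg : ∀ s ∈ S, ContDiffAt ℂ ω g s) :
    ContMDiff 𝓘(ℂ, M) 𝓘(ℂ, F) ω (fun s : S => g s) := fun s =>
  contMDiffAt_subtype_iff.mpr (hg s s.2).contMDiffAt

/-- Test against the linear function `q ↦ ⟪w, q.2⟫`, where `w` is the ball component of `s` itself: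
Cauchy–Schwarz bounds it by `‖w‖ * c` on `K`, and at `s` its modulus is `‖w‖ ^ 2`. -/
theorem norm_snd_le_of_mem_holomorphicHull {K : Set S} {c : ℝ}
    (hK : ∀ s ∈ K, ‖(s : ℂ × EuclideanSpace ℂ (Fin N)).2‖ ≤ c) {s : S}
    (hs : s ∈ holomorphicHull (ℂ × EuclideanSpace ℂ (Fin N)) K) :
    ‖(s : ℂ × EuclideanSpace ℂ (Fin N)).2‖ ≤ c ∨ K = ∅ := by
  rcases K.eq_empty_or_nonempty with h | ⟨k, hk⟩
  · exact Or.inr h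
  left
  have hc : 0 ≤ c := (norm_nonneg _).trans (hK k hk)
  let w := (s : ℂ × EuclideanSpace ℂ (Fin N)).2
  have h1 := hs (fun q : S => inner ℂ w (q : ℂ × EuclideanSpace ℂ (Fin N)).2)
    (contMDiff_opens_of_contDiffAt (S := S)
      (g := fun q : ℂ × EuclideanSpace ℂ (Fin N) => innerSL ℂ w q.2)
      fun q _ => (innerSL ℂ w).contDiff.contDiffAt.comp q contDiffAt_snd) (‖w‖ * c)
    (fun z hz => (norm_inner_le_norm _ _).trans (by gcongr; exact hK z hz))
  change ‖w‖ ≤ c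
  change ‖inner ℂ w w‖ ≤ ‖w‖ * c at h1
  rw [inner_self_eq_norm_sq_to_K, norm_pow, RCLike.norm_ofReal, abs_norm, pow_two] at h1
  by_contra! hlt
  nlinarith [norm_nonneg w]

theorem isClosed_holomorphicHull {M : Type*} [NormedAddCommGroup M] [NormedSpace ℂ M]
    {S : Type*} [TopologicalSpace S] [ChartedSpace M S] (K : Set S) :
    IsClosed (holomorphicHull M K) := by
  have : holomorphicHull M K = ⋂ (f : S → ℂ) (_ : ContMDiff 𝓘(ℂ, M) 𝓘(ℂ, ℂ) ω f) (c : ℝ)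
      (_ : ∀ z ∈ K, ‖f z‖ ≤ c), {s | ‖f s‖ ≤ c} := by
    ext s
    simp [holomorphicHull]
  rw [this]
  refine isClosed_iInter fun f => isClosed_iInter fun hf => isClosed_iInter fun c =>
    isClosed_iInter fun _ => isClosed_le hf.continuous.norm continuous_const

theorem holomorphicHull_empty {M : Type*} [NormedAddCommGroup M] [NormedSpace ℂ M]
    {S : Type*} [TopologicalSpace S] [ChartedSpace M S] :
    holomorphicHull M (∅ : Set S) = ∅ := by
  refine eq_empty_of_forall_notMem fun s hs => ?_
  have := hs (fun _ => 0) contMDiff_const (-1) (by simp)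
  norm_num at this

/-- The product of a plane open set and a ball is Stein. -/
theorem isSteinManifold_prod_ball (hO : IsOpen O) (hS : (S : Set (ℂ × EuclideanSpace ℂ (Fin N))) = O ×ˢ Metric.ball 0 ρ) :
    IsSteinManifold (ℂ × EuclideanSpace ℂ (Fin N)) S := by
  have hmem : ∀ q, q ∈ S ↔ q.1 ∈ O ∧ ‖q.2‖ < ρ := fun q => by
    rw [← SetLike.mem_coe, hS]
    simp
  constructor
  · intro K hK
    rcases K.eq_empty_or_nonempty with rfl | hne
    · rw [holomorphicHull_empty]
      exact isCompact_empty
    have hK1 : IsCompact ((fun s : S => (s : ℂ × EuclideanSpace ℂ (Fin N)).1) '' K) :=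
      hK.image (by fun_prop)
    obtain ⟨η, hη, hηO⟩ := hK1.exists_thickening_subset_open hO
      (by rintro _ ⟨s, -, rfl⟩; exact ((hmem s).mp s.2).1)
    obtain ⟨b, hb⟩ := hK1.isBounded.exists_norm_le
    obtain ⟨m, hm, hmax⟩ := hK.exists_isMaxOn hne (f := fun s : S =>
      ‖(s : ℂ × EuclideanSpace ℂ (Fin N)).2‖) (by fun_prop)
    set c := ‖(m : ℂ × EuclideanSpace ℂ (Fin N)).2‖ with hc
    -- A compact subset of `S` containing the hull. The three bounds come from the coordinate `z`,
    -- from `1 / (z - a)` with `a ∉ O`, and from linear functions on the ball; `c < ρ` because the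
    -- maximum is attained in `K`.
    let C : Set (ℂ × EuclideanSpace ℂ (Fin N)) :=
      {q | q.1 ∈ Metric.closedBall 0 b ∩ {z | ∀ a ∉ O, η ≤ ‖z - a‖}} ∩
        {q | q.2 ∈ Metric.closedBall 0 c}
    have hCc : IsCompact C := by
      have : C = (Metric.closedBall 0 b ∩ {z | ∀ a ∉ O, η ≤ ‖z - a‖}) ×ˢ
        Metric.closedBall 0 c := rfl
      rw [this]
      refine ((isCompact_closedBall 0 b).inter_right ?_).prod (isCompact_closedBall 0 c)
      simp only [ofPred_forall]
      exact isClosed_iInter fun a => isClosed_iInter fun _ => isClosed_le (by fun_prop) (by fun_prop)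
    have hCS : C ⊆ S := by
      rintro q ⟨⟨-, h2⟩, h3⟩
      refine (hmem q).mpr ⟨?_, ?_⟩
      · by_contra hq
        have := h2 _ hq
        simp at this
        linarith
      · have : ‖q.2‖ ≤ c := by simpa using h3
        exact this.trans_lt ((hmem m).mp m.2).2
    have hpre : IsCompact (((↑) : S → ℂ × EuclideanSpace ℂ (Fin N)) ⁻¹' C) :=
      (Topology.IsInducing.subtypeVal.isCompact_preimage_iff (by simpa using hCS)).mpr hCc
    refine hpre.of_isClosed_subset (isClosed_holomorphicHull K) fun s hs => ⟨⟨?_, ?_⟩, ?_⟩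
    · simpa using hs _ (contMDiff_opens_of_contDiffAt (g := Prod.fst) fun _ _ => contDiffAt_fst) b
        (fun z hz => hb _ (mem_image_of_mem _ hz))
    · intro a ha
      have hne : ∀ q ∈ S, q.1 - a ≠ 0 := fun q hq h =>
        ha (sub_eq_zero.mp h ▸ ((hmem q).mp hq).1)
      have h1 := hs _ (contMDiff_opens_of_contDiffAt (g := fun q => (q.1 - a)⁻¹) fun q hq =>
        (contDiffAt_fst.sub contDiffAt_const).inv (hne q hq)) η⁻¹ (fun z hz => by
          rw [norm_inv]
          refine inv_anti₀ hη ?_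
          by_contra! hlt
          refine ha (hηO (Metric.mem_thickening_iff.mpr ⟨_, mem_image_of_mem _ hz, ?_⟩))
          rwa [dist_comm, dist_eq_norm])
      rw [norm_inv] at h1
      exact (inv_le_inv₀ (norm_pos_iff.mpr (hne s s.2)) hη).mp h1
    · rcases norm_snd_le_of_mem_holomorphicHull (fun s hs => hmax hs) hs with h | h
      · simpa using h
      · exact absurd h hne.ne_empty
  · intro x y hxy
    by_cases h : (x : ℂ × EuclideanSpace ℂ (Fin N)).1 = (y : ℂ × EuclideanSpace ℂ (Fin N)).1
    · have h2 : (x : ℂ × EuclideanSpace ℂ (Fin N)).2 ≠ (y : ℂ × EuclideanSpace ℂ (Fin N)).2 :=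
        fun h2 => hxy (Subtype.ext (Prod.ext h h2))
      obtain ⟨i, hi⟩ : ∃ i, (x : ℂ × EuclideanSpace ℂ (Fin N)).2 i ≠
          (y : ℂ × EuclideanSpace ℂ (Fin N)).2 i := by
        by_contra! h3
        exact h2 (PiLp.ext h3)
      exact ⟨_, contMDiff_opens_of_contDiffAt (S := S)
        (g := fun q : ℂ × EuclideanSpace ℂ (Fin N) => (EuclideanSpace.proj i : _ →L[ℂ] ℂ) q.2)
        fun q _ => (EuclideanSpace.proj i : _ →L[ℂ] ℂ).contDiff.contDiffAt.comp q contDiffAt_snd, hi⟩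
    · exact ⟨_, contMDiff_opens_of_contDiffAt (g := Prod.fst) fun _ _ => contDiffAt_fst, h⟩

/-- Products of a polynomially convex plane set and a ball are holomorphically convex. -/
theorem holomorphicHull_prod_closedBall {D : Set ℂ}
    (hD : ∀ c ∉ D, ∃ p : Polynomial ℂ, p.eval c = 1 ∧ ∀ z ∈ D, ‖p.eval z‖ ≤ 1 / 2) (r : ℝ) :
    holomorphicHull (ℂ × EuclideanSpace ℂ (Fin N))
      (((↑) : S → ℂ × EuclideanSpace ℂ (Fin N)) ⁻¹' (D ×ˢ Metric.closedBall 0 r)) =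
      ((↑) : S → ℂ × EuclideanSpace ℂ (Fin N)) ⁻¹' (D ×ˢ Metric.closedBall 0 r) := by
  refine Subset.antisymm (fun s hs => ⟨?_, ?_⟩) fun s hs f _ c hc => hc s hs
  · by_contra hsD
    obtain ⟨p, hp1, hp2⟩ := hD _ hsD
    have hp : ContDiff ℂ ω fun z : ℂ => p.eval z := by
      simpa using p.contDiff_aeval (𝕜 := ℂ) ω
    have h1 := hs _ (contMDiff_opens_of_contDiffAt
      (g := fun q : ℂ × EuclideanSpace ℂ (Fin N) => p.eval q.1) fun q _ =>
      (hp.comp contDiff_fst).contDiffAt) (1 / 2) (fun z hz => hp2 _ hz.1)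
    rw [hp1] at h1
    norm_num at h1
  · rcases norm_snd_le_of_mem_holomorphicHull (c := r) (fun s hs => by simpa using hs.2) hs with h | h
    · simpa using h
    · rw [h, holomorphicHull_empty] at hs
      exact absurd hs (notMem_empty s)

end Products

/-! ### Liftings from the Oka property and from the Serre property -/

section Lifting

variable {E₁ : Type*} [NormedAddCommGroup E₁] [NormedSpace ℂ E₁]
variable {E₂ : Type*} [NormedAddCommGroup E₂] [NormedSpace ℂ E₂]
variable {X : Type*} [TopologicalSpace X] [ChartedSpace E₁ X]
variable {Y : Type*} [TopologicalSpace Y] [ChartedSpace E₂ Y]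

/-- The nonparametric case of the Oka property over the product of a plane open set and a ball. -/
theorem HasPOPAI.exists_lift {h : X → Y} (hh : HasPOPAI E₁ E₂ h) {N : ℕ} {O D : Set ℂ} {ρ r : ℝ}
    {S : TopologicalSpace.Opens (ℂ × EuclideanSpace ℂ (Fin N))}
    (hO : IsOpen O) (hS : (S : Set (ℂ × EuclideanSpace ℂ (Fin N))) = O ×ˢ Metric.ball 0 ρ) (hDc : IsCompact D)
    (hDS : D ×ˢ Metric.closedBall 0 r ⊆ (S : Set (ℂ × EuclideanSpace ℂ (Fin N))))
    (hD : ∀ c ∉ D, ∃ p : Polynomial ℂ, p.eval c = 1 ∧ ∀ z ∈ D, ‖p.eval z‖ ≤ 1 / 2)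
    {A : Set S} (hA : IsClosedSubvariety (ℂ × EuclideanSpace ℂ (Fin N)) A)
    {f : ℂ × EuclideanSpace ℂ (Fin N) → X} (hf : ContinuousOn f S)
    (hhf : ContMDiffOn 𝓘(ℂ, ℂ × EuclideanSpace ℂ (Fin N)) 𝓘(ℂ, E₂) ω (fun q => h (f q)) S)
    {U : Set (ℂ × EuclideanSpace ℂ (Fin N))} (hU : IsOpen U) (hDU : D ×ˢ Metric.closedBall 0 r ⊆ U)
    (hfU : ContMDiffOn 𝓘(ℂ, ℂ × EuclideanSpace ℂ (Fin N)) 𝓘(ℂ, E₁) ω f U)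
    (hfA : IsHolomorphicOnSubvariety (ℂ × EuclideanSpace ℂ (Fin N)) E₁ (fun s : S => f s) A)
    (d : MetricSpace X) (hd : IsCompatibleMetric d) {ε : ℝ} (hε : 0 < ε) :
    ∃ g : ℂ × EuclideanSpace ℂ (Fin N) → X,
      ContMDiffOn 𝓘(ℂ, ℂ × EuclideanSpace ℂ (Fin N)) 𝓘(ℂ, E₁) ω g S ∧
      (∀ q ∈ S, h (g q) = h (f q)) ∧ (∀ s ∈ A, g s = f s) ∧
      ∀ q ∈ D ×ˢ Metric.closedBall (0 : EuclideanSpace ℂ (Fin N)) r, d.dist (f q) (g q) < ε := by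
  classical
  -- The parameter space is the one-point space `ℝ⁰`, with `P₀` empty.
  obtain ⟨Φ, -, -, hΦ2, hΦ3, -, hΦ5, hΦ6⟩ := hh (ℂ × EuclideanSpace ℂ (Fin N)) S
    (isSteinManifold_prod_ball hO hS)
    (((↑) : S → ℂ × EuclideanSpace ℂ (Fin N)) ⁻¹' (D ×ˢ Metric.closedBall 0 r)) A
    ((Topology.IsInducing.subtypeVal.isCompact_preimage_iff (by simpa using hDS)).mpr
      (hDc.prod (isCompact_closedBall 0 r)))
    (holomorphicHull_prod_closedBall hD r) hA 0 {0} ∅ isCompact_singleton isCompact_empty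
    (empty_subset _) (fun _ s => f s)
    ((continuousOn_iff_continuous_domRestrict.mp hf).comp continuous_snd)
    (fun _ s => contMDiffAt_subtype_iff.mpr (hhf.contMDiffAt (S.2.mem_nhds s.2)))
    (fun p hp => absurd hp (notMem_empty _))
    ⟨((↑) : S → ℂ × EuclideanSpace ℂ (Fin N)) ⁻¹' U, hU.preimage continuous_subtype_val,
      preimage_mono hDU, fun _ s hs => (contMDiffAt_subtype_iff.mpr
        (hfU.contMDiffAt (hU.mem_nhds hs))).contMDiffWithinAt⟩
    (fun _ => hfA) d hd ε hε
  let p : ({0} : Set (EuclideanSpace ℝ (Fin 0))) := ⟨0, rfl⟩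
  let g : ℂ × EuclideanSpace ℂ (Fin N) → X := fun q => if hq : q ∈ S then Φ 1 p ⟨q, hq⟩ else f q
  have hg : ∀ s : S, g s = Φ 1 p s := fun s => by simp [g]
  refine ⟨g, fun q hq => ?_, fun q hq => ?_, fun s hs => ?_, fun q hq => ?_⟩
  · have h1 : ContMDiffAt 𝓘(ℂ, ℂ × EuclideanSpace ℂ (Fin N)) 𝓘(ℂ, E₁) ω (fun s : S => g s)
        (⟨q, hq⟩ : S) := by
      rw [funext hg]
      exact hΦ6 p _
    exact (contMDiffAt_subtype_iff.mp h1).contMDiffWithinAt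
  · exact (congrArg h (hg ⟨q, hq⟩)).trans (hΦ2 1 p ⟨q, hq⟩)
  · exact (hg s).trans (hΦ3 1 p s (Or.inr hs))
  · have := hΦ5 1 p ⟨q, hDS hq⟩ hq
    rwa [← hg] at this

end Lifting

/-- Homotopy lifting for Serre fibrations over balls of finite dimensional spaces. -/
theorem IsSerreFibration.exists_lift_closedBall {X Y : Type*} [TopologicalSpace X]
    [TopologicalSpace Y] {h : X → Y} (hh : IsSerreFibration h) {T : Type*} [NormedAddCommGroup T]
    [NormedSpace ℝ T] [FiniteDimensional ℝ T] {H : T × I → Y} (hH : Continuous H) {f : T → X}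
    (hf : Continuous f) (hfH : ∀ a, h (f a) = H (a, 0)) (R : ℝ) :
    ∃ L : T × I → X, Continuous L ∧ (∀ a, ‖a‖ ≤ R → ∀ t, h (L (a, t)) = H (a, t)) ∧
      ∀ a, ‖a‖ ≤ R → L (a, 0) = f a := by
  let n := Module.finrank ℝ T
  let φ : T ≃L[ℝ] (Fin n → ℝ) := ContinuousLinearEquiv.ofFinrankEq (by simp [n])
  obtain ⟨m, hm0, hm⟩ : ∃ m : ℝ, 0 < m ∧ ∀ a, ‖a‖ ≤ R → ‖φ a‖ ≤ m := by
    refine ⟨max 1 (‖(φ : T →L[ℝ] (Fin n → ℝ))‖ * R), by positivity, fun a ha => ?_⟩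
    refine ((φ : T →L[ℝ] (Fin n → ℝ)).le_opNorm a).trans (le_trans ?_ (le_max_right _ _))
    gcongr
  -- Clamping to a cube whose image under `u` contains the ball of radius `R`; `u ∘ c` is the
  -- identity on that ball.
  let c : T → (Fin n → I) := fun a i => projIcc 0 1 zero_le_one ((φ a i + m) / (2 * m))
  let u : (Fin n → I) → T := fun s => φ.symm fun i => 2 * m * s i - m
  have hc : Continuous c := by
    refine continuous_pi fun i => continuous_projIcc.comp ?_
    have : Continuous fun a => φ a i := (continuous_apply i).comp φ.continuous
    fun_prop
  have hu : Continuous u := φ.symm.continuous.comp (by fun_prop)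
  have huc : ∀ a, ‖a‖ ≤ R → u (c a) = a := by
    intro a ha
    have : (fun i => 2 * m * (c a i : ℝ) - m) = φ a := by
      ext i
      have h1 : |φ a i| ≤ m := (norm_le_pi_norm (φ a) i).trans (hm a ha)
      rw [abs_le] at h1
      have h2 : (φ a i + m) / (2 * m) ∈ Icc (0 : ℝ) 1 :=
        ⟨div_nonneg (by linarith) (by linarith), (div_le_one (by linarith)).mpr (by linarith)⟩
      simp only [c, projIcc_of_mem zero_le_one h2]
      field_simp
      ring
    simp only [u, this, φ.symm_apply_apply]
  obtain ⟨L, hL, hL1, hL2⟩ := hh.2 n (fun p => H (u p.1, p.2)) (fun s => f (u s)) (by fun_prop)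
    (by fun_prop) (fun s => hfH _)
  refine ⟨fun p => L (c p.1, p.2), by fun_prop, fun a ha t => ?_, fun a ha => ?_⟩
  · simp only [hL1, huc a ha]
  · simp only [hL2, huc a ha]

theorem isOpen_setOf_forall_prodMk_mem {Z T : Type*} [TopologicalSpace Z] [TopologicalSpace T]
    [CompactSpace T] {A : Set (Z × T)} (hA : IsOpen A) : IsOpen {z | ∀ t, (z, t) ∈ A} := by
  have : {z | ∀ t, (z, t) ∈ A} = (Prod.fst '' Aᶜ)ᶜ := by
    ext z
    simp
  rw [this, isOpen_compl_iff]
  exact isClosedMap_fst_of_compactSpace _ hA.isClosed_compl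

/-- The larger disc of a special pair deforms onto the smaller one inside itself. -/
theorem IsSpecialPair.exists_deformation {D D' : Set ℂ} (hDD : IsSpecialPair D D') :
    ∃ δ : ℂ × I → ℂ, ContinuousOn δ (D' ×ˢ univ) ∧ (∀ z ∈ D', ∀ t, δ (z, t) ∈ D') ∧
      (∀ z ∈ D', δ (z, 0) ∈ D) ∧ (∀ z ∈ D', δ (z, 1) = z) ∧ ∀ z ∈ D, ∀ t, δ (z, t) = z := by
  classical
  obtain ⟨hD, hD', hsub, e, he, hrange, hside, -⟩ := hDD
  have hDc : IsClosed D := hD.isCompact.isClosed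
  have hCD' : range e ⊆ D' := by
    rw [hrange]
    exact closure_minimal sdiff_subset hD'.isCompact.isClosed
  have hD'C : D' ⊆ D ∪ range e := fun z hz => by
    by_cases h : z ∈ D
    · exact Or.inl h
    · exact Or.inr (hrange ▸ subset_closure ⟨hz, h⟩)
  rw [← hrange] at hside
  let j : ℂ → I × I := Function.invFun e
  have hj : ∀ q, j (e q) = q := Function.leftInverse_invFun he.injective
  have hjc : ContinuousOn j (range e) := by
    rw [continuousOn_iff_continuous_domRestrict]
    have : (range e).domRestrict j = he.toHomeomorph.symm := by
      ext1 z
      obtain ⟨q, rfl⟩ := he.toHomeomorph.surjective z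
      rw [he.toHomeomorph.symm_apply_apply]
      exact hj q
    rw [this]
    exact he.toHomeomorph.symm.continuous
  -- The attached square is pushed into its side `{0} × [0,1]` by scaling the first coordinate.
  let δ : ℂ × I → ℂ := fun p =>
    if p.1 ∈ D then p.1 else e ((j p.1).1 * p.2, (j p.1).2)
  have hδD : ∀ z ∈ D, ∀ t, δ (z, t) = z := fun z hz t => if_pos hz
  have hδe : ∀ q t, δ (e q, t) = e (q.1 * t, q.2) := by
    intro q t
    by_cases h : e q ∈ D
    · rw [hδD _ h]
      have : e q ∈ e '' {q | q.1 = 0} := hside ▸ ⟨h, mem_range_self q⟩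
      rw [he.injective.mem_set_image] at this
      have h0 : q.1 = 0 := this
      rw [h0, zero_mul, ← h0]
    · simp [δ, h, hj]
  refine ⟨δ, ?_, ?_, ?_, ?_, hδD⟩
  · have h1 : ContinuousOn δ (D ×ˢ univ) :=
      continuousOn_fst.congr fun p hp => hδD p.1 hp.1 p.2
    have h2 : ContinuousOn δ (range e ×ˢ univ) := by
      have hj' : ContinuousOn (fun p : ℂ × I => j p.1) (range e ×ˢ univ) :=
        hjc.comp continuousOn_fst fun p hp => hp.1
      have : ContinuousOn (fun p : ℂ × I => e ((j p.1).1 * p.2, (j p.1).2)) (range e ×ˢ univ) :=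
        he.continuous.comp_continuousOn
          ((hj'.fst.mul continuousOn_snd).prodMk hj'.snd)
      refine this.congr ?_
      rintro ⟨_, t⟩ ⟨⟨q, rfl⟩, -⟩
      simp only [hδe, hj]
    refine (h1.union_of_isClosed h2 (hDc.prod isClosed_univ) ?_).mono ?_
    · exact (isCompact_range he.continuous).isClosed.prod isClosed_univ
    · rw [← union_prod]
      exact prod_mono hD'C le_rfl
  · intro z hz t
    rcases hD'C hz with h | ⟨q, rfl⟩
    · rwa [hδD z h]
    · rw [hδe]
      exact hCD' (mem_range_self _)
  · intro z hz
    rcases hD'C hz with h | ⟨q, rfl⟩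
    · rwa [hδD z h]
    · rw [hδe, mul_zero]
      have : e (0, q.2) ∈ D ∩ range e := hside ▸ mem_image_of_mem e rfl
      exact this.1
  · intro z hz
    rcases hD'C hz with h | ⟨q, rfl⟩
    · rw [hδD z h]
    · rw [hδe, mul_one]

/-- For a special pair, points near the larger disc can be reached from a neighbourhood `U` of
the smaller one along a continuous family of paths; near the smaller disc the paths are stopped
immediately. -/
theorem IsSpecialPair.exists_stopped_homotopy {D D' : Set ℂ} (hDD : IsSpecialPair D D')
    {U W : Set ℂ} (hU : IsOpen U) (hDU : D ⊆ U) (hW : IsOpen W) (hDW : D' ⊆ W) :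
    ∃ (O O₀ : Set ℂ) (η : ℂ × I → ℂ) (μ : ℂ → I), IsOpen O ∧ D' ⊆ O ∧ IsOpen O₀ ∧ D ⊆ O₀ ∧
      O₀ ⊆ O ∧ Continuous η ∧ Continuous μ ∧ (∀ q, η q ∈ W) ∧ (∀ z, η (z, 0) ∈ U) ∧
      (∀ z ∈ O, η (z, μ z) = z) ∧ ∀ z ∈ O₀, μ z = 0 := by
  obtain ⟨δ, hδ, hδD', hδ0, hδ1, hδD⟩ := hDD.exists_deformation
  obtain ⟨hD, hD', hsub, -⟩ := hDD
  obtain ⟨R, hR, hRD, hRid⟩ := hD'.exists_retraction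
  have hΔ : Continuous (fun p : ℂ × I => δ (R p.1, p.2)) := by
    rw [← continuousOn_univ]
    exact hδ.comp (by fun_prop) fun p _ => ⟨hRD _, mem_univ _⟩
  let Ω : Set ℂ := {z | ∀ t : I, R z + (t : ℝ) * (z - R z) ∈ W}
  have hΩ : IsOpen Ω := isOpen_setOf_forall_prodMk_mem
    (A := {p : ℂ × I | R p.1 + (p.2 : ℝ) * (p.1 - R p.1) ∈ W}) (hW.preimage (by fun_prop))
  have hDΩ : D' ⊆ Ω := fun z hz t => by simpa [hRid z hz] using hDW hz
  obtain ⟨O, hO, hDO, hOΩ⟩ := normal_exists_closure_subset hD'.isCompact.isClosed hΩ hDΩ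
  obtain ⟨κ, hκ0, hκ1, hκ⟩ := exists_continuous_zero_one_of_isClosed hΩ.isClosed_compl
    (isClosed_closure (s := O)) (disjoint_compl_left_iff_subset.mpr hOΩ)
  let π : ℝ → I := projIcc 0 1 zero_le_one
  have hπ : Continuous π := continuous_projIcc
  -- The path of `z` runs from a point of `D` to `R z` inside `D'`, then straight from `R z` towards
  -- `z`. The cutoff `κ` keeps the second half in `W` and equals `1` on `O`, so there the path ends
  -- at `z`.
  let g : ℂ × I → ℂ := fun p =>
    δ (R p.1, π (2 * p.2)) + ((π (2 * p.2 - 1) : ℝ) * κ p.1 : ℝ) * (p.1 - R p.1)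
  have hg : Continuous g := by
    refine Continuous.add ?_ (by fun_prop)
    exact hΔ.comp (g := fun p : ℂ × I => δ (R p.1, p.2)) (f := fun p : ℂ × I => (p.1, π (2 * p.2)))
      (by fun_prop)
  have hgW : ∀ p, g p ∈ W := by
    rintro ⟨z, t⟩
    rcases le_total (2 * (t : ℝ)) 1 with h | h
    · have : π (2 * t - 1) = 0 := projIcc_of_le_left _ (by linarith)
      simp only [g, this, Icc.coe_zero, zero_mul, Complex.ofReal_zero, add_zero]
      exact hDW (hδD' _ (hRD z) _)
    · have : π (2 * t) = 1 := projIcc_of_right_le _ h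
      simp only [g, this, hδ1 _ (hRD z)]
      by_cases hz : z ∈ Ω
      · exact hz ⟨_, mul_nonneg (π (2 * t - 1)).2.1 (hκ z).1,
          mul_le_one₀ (π (2 * t - 1)).2.2 (hκ z).1 (hκ z).2⟩
      · have : κ z = 0 := hκ0 hz
        simpa [this] using hDW (hRD z)
  have hg0 : ∀ z, g (z, 0) ∈ D := fun z => by
    have h1 : π (2 * ((0 : I) : ℝ) - 1) = 0 := projIcc_of_le_left _ (by simp)
    have h2 : π (2 * ((0 : I) : ℝ)) = 0 := projIcc_of_le_left _ (by simp)
    simp only [g, h1, h2]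
    simpa using hδ0 _ (hRD z)
  have hg1 : ∀ z ∈ O, g (z, 1) = z := fun z hz => by
    have h1 : π (2 * ((1 : I) : ℝ) - 1) = 1 := projIcc_of_right_le _ (by norm_num)
    have h2 : π (2 * ((1 : I) : ℝ)) = 1 := projIcc_of_right_le _ (by norm_num)
    have h3 : κ z = 1 := hκ1 (subset_closure hz)
    simp only [g, h1, h2, h3, hδ1 _ (hRD z)]
    simp
  have hgD : ∀ z ∈ D, ∀ t, g (z, t) = z := fun z hz t => by
    simp [g, hRid z (hsub hz), hδD z hz]
  let U₁ : Set ℂ := {z | ∀ t, g (z, t) ∈ U}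
  have hU₁ : IsOpen U₁ := isOpen_setOf_forall_prodMk_mem (hU.preimage hg)
  have hDU₁ : D ⊆ U₁ := fun z hz t => by
    rw [hgD z hz]
    exact hDU hz
  obtain ⟨O₀, hO₀, hDO₀, hO₀U⟩ := normal_exists_closure_subset hD.isCompact.isClosed
    (hU₁.inter hO) (subset_inter hDU₁ (hsub.trans hDO))
  obtain ⟨μ, hμ0, hμ1, hμ⟩ := exists_continuous_zero_one_of_isClosed
    (isClosed_closure (s := O₀)) hU₁.isClosed_compl
    (disjoint_compl_right_iff_subset.mpr (hO₀U.trans inter_subset_left))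
  -- The path is entered at time `1 - μ z`, so time `1` is reached at `t = μ z`. On `U₁` any entry
  -- point lies in `U`; off `U₁`, `μ = 1` and the path starts in `D`.
  refine ⟨O, O₀, fun p => g (p.1, π (1 - μ p.1 + p.2)), fun z => ⟨μ z, hμ z⟩, hO, hDO, hO₀, hDO₀,
    (subset_closure.trans hO₀U).trans inter_subset_right, by fun_prop, by fun_prop,
    fun q => hgW _, fun z => ?_, fun z hz => ?_, fun z hz => ?_⟩
  · by_cases hz : z ∈ U₁
    · exact hz _
    · have h1 : μ z = 1 := hμ1 hz
      have h2 : π (1 - μ z + ((0 : I) : ℝ)) = 0 := projIcc_of_le_left _ (by simp [h1])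
      simp only [h2]
      exact hDU (hg0 z)
  · have h2 : π (1 - μ z + μ z) = 1 := projIcc_of_right_le _ (by simp)
    simp only [h2, hg1 z hz]
  · exact Subtype.ext (hμ0 (subset_closure hz))

/-- A continuous map into a closed ball that is the identity on it. -/
theorem exists_retraction_closedBall (F : Type*) [NormedAddCommGroup F] [NormedSpace ℝ F] {r : ℝ}
    (hr : 0 < r) : ∃ R : F → F, Continuous R ∧ (∀ w, R w ∈ Metric.closedBall 0 r) ∧
      ∀ w ∈ Metric.closedBall 0 r, R w = w := by
  have hpos : ∀ w : F, 0 < max r ‖w‖ := fun w => hr.trans_le (le_max_left _ _)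
  refine ⟨fun w => (r / max r ‖w‖) • w, ?_, fun w => ?_, fun w hw => ?_⟩
  · exact (continuous_const.div (by fun_prop) fun w => (hpos w).ne').smul continuous_id
  · rw [mem_closedBall_zero_iff, norm_smul, Real.norm_of_nonneg (div_nonneg hr.le (hpos w).le),
      div_mul_eq_mul_div, div_le_iff₀ (hpos w)]
    gcongr
    exact le_max_right _ _
  · rw [mem_closedBall_zero_iff] at hw
    simp [max_eq_left hw, hr.ne']

/-- A lifting over a neighbourhood of the smaller disc of a special pair extends to the
larger one. -/
theorem IsSerreFibration.exists_extension {X Y : Type*} [TopologicalSpace X]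
    [TopologicalSpace Y] {h : X → Y} (hh : IsSerreFibration h) {D D' : Set ℂ}
    (hDD : IsSpecialPair D D') {F : Type*} [NormedAddCommGroup F] [NormedSpace ℝ F]
    [FiniteDimensional ℝ F] {r : ℝ} (hr : 0 < r) {U W : Set ℂ} (hU : IsOpen U) (hDU : D ⊆ U)
    (hW : IsOpen W) (hDW : D' ⊆ W) {G : ℂ × F → Y}
    (hG : ContinuousOn G (W ×ˢ Metric.closedBall 0 r)) {f : ℂ × F → X}
    (hf : ContinuousOn f (U ×ˢ Metric.closedBall 0 r))
    (hfG : ∀ q ∈ U ×ˢ Metric.closedBall 0 r, h (f q) = G q) :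
    ∃ (O O₀ : Set ℂ) (g : ℂ × F → X), IsOpen O ∧ D' ⊆ O ∧ O ⊆ W ∧ IsOpen O₀ ∧ D ⊆ O₀ ∧
      O₀ ⊆ O ∧ O₀ ⊆ U ∧ Continuous g ∧ (∀ q ∈ O ×ˢ Metric.ball 0 r, h (g q) = G q) ∧
      ∀ q ∈ O₀ ×ˢ Metric.ball 0 r, g q = f q := by
  obtain ⟨O, O₀, η, μ, hO, hDO, hO₀, hDO₀, hOO, hη, hμ, hηW, hηU, hημ, hμ0⟩ :=
    hDD.exists_stopped_homotopy hU hDU hW hDW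
  obtain ⟨R, hR, hRr, hRid⟩ := exists_retraction_closedBall F hr
  obtain ⟨b, hb⟩ := hDD.2.1.isCompact.isBounded.exists_norm_le
  have hH : Continuous (fun p : (ℂ × F) × I => G (η (p.1.1, p.2), R p.1.2)) := by
    rw [← continuousOn_univ]
    exact hG.comp (by fun_prop) fun p _ => ⟨hηW _, hRr _⟩
  have hf' : Continuous (fun p : ℂ × F => f (η (p.1, 0), R p.2)) := by
    rw [← continuousOn_univ]
    exact hf.comp (by fun_prop) fun p _ => ⟨hηU _, hRr _⟩
  -- The extension is this lift evaluated at the stopping time `μ z`: the path has then arrived at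
  -- `z`, so the value lies over `G`; near `D` the stopping time is `0`, so the value is that of
  -- `f`.
  obtain ⟨L, hL, hL1, hL2⟩ := hh.exists_lift_closedBall hH hf' (fun p => hfG _ ⟨hηU _, hRr _⟩)
    (max (b + 1) r)
  have hη0 : ∀ z ∈ O₀, η (z, 0) = z := fun z hz => by
    have := hημ z (hOO hz)
    rwa [hμ0 z hz] at this
  have hnorm : ∀ q ∈ (O ∩ Metric.ball 0 (b + 1)) ×ˢ Metric.ball (0 : F) r,
      ‖q‖ ≤ max (b + 1) r := fun q hq =>
    max_le_max (mem_ball_zero_iff.mp hq.1.2).le (mem_ball_zero_iff.mp hq.2).le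
  have hDb : D' ⊆ Metric.ball 0 (b + 1) := fun z hz =>
    mem_ball_zero_iff.mpr ((hb z hz).trans_lt (lt_add_one b))
  refine ⟨O ∩ Metric.ball 0 (b + 1), O₀ ∩ Metric.ball 0 (b + 1), fun q => L (q, μ q.1),
    hO.inter Metric.isOpen_ball, subset_inter hDO hDb, fun z hz => ?_,
    hO₀.inter Metric.isOpen_ball, subset_inter hDO₀ (hDD.2.2.1.trans hDb),
    inter_subset_inter_left _ hOO, fun z hz => ?_, by fun_prop, fun q hq => ?_, fun q hq => ?_⟩
  · rw [← hημ z hz.1]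
    exact hηW _
  · rw [← hη0 z hz.1]
    exact hηU _
  · rw [hL1 q (hnorm q hq), hημ _ hq.1.1, hRid _ (Metric.ball_subset_closedBall hq.2)]
  · simp only [hμ0 _ hq.1.1]
    rw [hL2 q (hnorm q ⟨⟨hOO hq.1.1, hq.1.2⟩, hq.2⟩), hη0 _ hq.1.1,
      hRid _ (Metric.ball_subset_closedBall hq.2)]

/-- At the origin continuity holds because the image vector has norm `√‖w‖`. -/
theorem continuous_inv_sqrt_norm_smul (F : Type*) [NormedAddCommGroup F] [NormedSpace ℝ F] :
    Continuous fun w : F => (√‖w‖)⁻¹ • w := by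
  rw [continuous_iff_continuousAt]
  intro w
  rcases eq_or_ne w 0 with rfl | hw
  · have h1 : Filter.Tendsto (fun w : F => √‖w‖) (𝓝 0) (𝓝 0) := by
      have : Continuous fun w : F => √‖w‖ := by fun_prop
      simpa using this.tendsto 0
    rw [ContinuousAt, smul_zero, tendsto_zero_iff_norm_tendsto_zero]
    refine h1.congr fun w => ?_
    rw [norm_smul, norm_inv, Real.norm_of_nonneg (Real.sqrt_nonneg _), inv_mul_eq_div,
      Real.div_sqrt]
  · exact ContinuousAt.smul (ContinuousAt.inv₀ (by fun_prop)
      (Real.sqrt_ne_zero'.mpr (norm_pos_iff.mpr hw))) continuousAt_id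

/-- A Serre fibration has continuous local sections with a prescribed value over any ball. -/
theorem IsSerreFibration.exists_section_closedBall {X Y : Type*} [TopologicalSpace X]
    [TopologicalSpace Y] {h : X → Y} (hh : IsSerreFibration h) {F : Type*} [NormedAddCommGroup F]
    [NormedSpace ℝ F] [FiniteDimensional ℝ F] {r : ℝ} (hr : 0 < r) (hr1 : r ≤ 1) {c : F → Y}
    (hc : ContinuousOn c (Metric.closedBall 0 r)) {x : X} (hx : h x = c 0) :
    ∃ γ : F → X, Continuous γ ∧ (∀ w ∈ Metric.closedBall 0 r, h (γ w) = c w) ∧ γ 0 = x := by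
  obtain ⟨R, hR, hRr, hRid⟩ := exists_retraction_closedBall F hr
  have hH : Continuous (fun p : F × I => c (R ((p.2 : ℝ) • p.1))) := by
    rw [← continuousOn_univ]
    exact hc.comp (by fun_prop) fun p _ => hRr _
  obtain ⟨L, hL, hL1, hL2⟩ := hh.exists_lift_closedBall hH (continuous_const (y := x))
    (fun a => by simp [hRid 0 (Metric.mem_closedBall_self hr.le), hx]) 1
  have hcont := continuous_inv_sqrt_norm_smul F
  -- `L` lifts the rays `t ↦ c (t • a)` from the constant `x`. The value `L (0, 1)` need not be `x`,
  -- so `w` is split as `√‖w‖ • (w / √‖w‖)`: both factors are continuous in `w`, and `w = 0` gives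
  -- time `0`.
  refine ⟨fun w => L ((√‖w‖)⁻¹ • w, projIcc 0 1 zero_le_one (√‖w‖)), ?_, fun w hw => ?_, ?_⟩
  · exact hL.comp (hcont.prodMk (continuous_projIcc.comp (by fun_prop)))
  · have hw' : ‖w‖ ≤ r := by simpa using hw
    have h1 : √‖w‖ ≤ 1 := Real.sqrt_le_one.mpr (hw'.trans hr1)
    rw [hL1, projIcc_of_mem zero_le_one ⟨Real.sqrt_nonneg _, h1⟩]
    · rcases eq_or_ne w 0 with rfl | h0
      · simp [hRid 0 (Metric.mem_closedBall_self hr.le)]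
      · rw [smul_inv_smul₀ (Real.sqrt_ne_zero'.mpr (norm_pos_iff.mpr h0)), hRid w hw]
    · rwa [norm_smul, norm_inv, Real.norm_of_nonneg (Real.sqrt_nonneg _), inv_mul_eq_div,
        Real.div_sqrt]
  · have : projIcc (0 : ℝ) 1 zero_le_one (√‖(0 : F)‖) = 0 := by
      simp
    simp only [this]
    exact hL2 _ (by simp)

/-! ### Oka maps are submersions, and the property ascends along them -/

section Oka

variable {E : Type*} [NormedAddCommGroup E] [NormedSpace ℂ E] [FiniteDimensional ℂ E]
variable {X : Type*} [TopologicalSpace X] [T2Space X] [SecondCountableTopology X]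
  [ChartedSpace E X]
variable {E₂ : Type*} [NormedAddCommGroup E₂] [NormedSpace ℂ E₂] [FiniteDimensional ℂ E₂]
variable {Y : Type*} [TopologicalSpace Y] [ChartedSpace E₂ Y] [IsManifold 𝓘(ℂ, E₂) ω Y]

/-- Oka maps are submersions. -/
theorem IsOkaMap.surjective_mfderiv {h : X → Y} (hh : IsOkaMap E E₂ h) (x : X) :
    Function.Surjective (mfderiv 𝓘(ℂ, E) 𝓘(ℂ, E₂) h x) := by
  obtain ⟨hhol, hserre, hoka⟩ := hh
  set ey := extChartAt 𝓘(ℂ, E₂) (h x) with hey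
  let N := Module.finrank ℂ E₂
  let φ : EuclideanSpace ℂ (Fin N) ≃L[ℂ] E₂ := ContinuousLinearEquiv.ofFinrankEq (by simp [N])
  obtain ⟨r, hr, hr1, hrt⟩ : ∃ r : ℝ, 0 < r ∧ r ≤ 1 ∧
      ∀ w ∈ Metric.closedBall (0 : EuclideanSpace ℂ (Fin N)) r, ey (h x) + φ w ∈ ey.target := by
    have hc : ContinuousAt (fun w => ey (h x) + φ w) 0 := by fun_prop
    have h1 : ey.target ∈ 𝓝 (ey (h x) + φ 0) := by
      rw [map_zero, add_zero]
      exact extChartAt_target_mem_nhds (h x)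
    obtain ⟨s, hs, hst⟩ := Metric.nhds_basis_closedBall.mem_iff.mp (hc h1)
    exact ⟨min s 1, lt_min hs one_pos, min_le_right _ _, fun w hw =>
      hst (Metric.closedBall_subset_closedBall (min_le_left _ _) hw)⟩
  let c : EuclideanSpace ℂ (Fin N) → Y := fun w => ey.symm (ey (h x) + φ w)
  have hsymm : ContMDiffOn 𝓘(ℂ, E₂) 𝓘(ℂ, E₂) ω ey.symm ey.target := contMDiffOn_extChartAt_symm _
  have hc : ContMDiffOn 𝓘(ℂ, EuclideanSpace ℂ (Fin N)) 𝓘(ℂ, E₂) ω c (Metric.closedBall 0 r) := by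
    refine hsymm.comp (t := ey.target) ?_ hrt
    exact (contDiff_const.add φ.contDiff).contMDiff.contMDiffOn
  obtain ⟨γ, hγ, hγc, hγ0⟩ := hserre.exists_section_closedBall hr hr1 hc.continuousOn (x := x)
    (by simp [c, ey])
  obtain ⟨d, hd⟩ := exists_isCompatibleMetric E X
  let S : TopologicalSpace.Opens (ℂ × EuclideanSpace ℂ (Fin N)) :=
    ⟨univ ×ˢ Metric.ball 0 r, isOpen_univ.prod Metric.isOpen_ball⟩
  let A : Set S := {s | (s : ℂ × EuclideanSpace ℂ (Fin N)).2 = 0}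
  have hA : IsClosedSubvariety (ℂ × EuclideanSpace ℂ (Fin N)) A := by
    refine ⟨isClosed_eq (by fun_prop) continuous_const, fun s _ => ⟨univ, isOpen_univ, mem_univ _,
      N, fun i s => (EuclideanSpace.proj i : _ →L[ℂ] ℂ)
        (s : ℂ × EuclideanSpace ℂ (Fin N)).2, fun i => ?_, ?_⟩⟩
    · exact (contMDiff_opens_of_contDiffAt (S := S)
        (g := fun q : ℂ × EuclideanSpace ℂ (Fin N) => (EuclideanSpace.proj i : _ →L[ℂ] ℂ) q.2)
        fun q _ => (EuclideanSpace.proj i : _ →L[ℂ] ℂ).contDiff.contDiffAt.comp q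
          contDiffAt_snd).contMDiffOn
    · ext s
      simp only [A, inter_univ, mem_univ, true_and, mem_ofPred_eq]
      exact ⟨fun h i => by simp [h], fun h => PiLp.ext h⟩
  -- The continuous lift `γ` of the inverse chart is made holomorphic. Nothing is approximated;
  -- interpolation on `w = 0`, where the lift is constantly `x`, keeps it passing through `x`. The
  -- factor `ℂ` is a dummy variable.
  obtain ⟨g, hg, hgh, hgA, -⟩ := hoka.exists_lift (S := S) (D := ∅) (r := r) isOpen_univ rfl
    isCompact_empty (by simp) (fun c _ => ⟨1, by simp⟩) hA
    (f := fun q => γ q.2) (by fun_prop)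
    (by
      refine (ContMDiffOn.comp (t := Metric.closedBall 0 r) (g := c) (f := Prod.snd) hc
        contDiff_snd.contMDiff.contMDiffOn fun q hq => Metric.ball_subset_closedBall hq.2).congr ?_
      exact fun q hq => hγc _ (Metric.ball_subset_closedBall hq.2))
    isOpen_empty (by simp) (by intro q hq; exact absurd hq (notMem_empty q))
    (fun s _ => ⟨univ, fun _ => x, isOpen_univ, mem_univ _, contMDiffOn_const, fun t ht => by
      have h0 : (t : ℂ × EuclideanSpace ℂ (Fin N)).2 = 0 := ht.1
      simp only [h0, hγ0]⟩)
    d hd one_pos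
  have hS0 : ((0 : ℂ), (0 : EuclideanSpace ℂ (Fin N))) ∈ S :=
    ⟨mem_univ _, Metric.mem_ball_self hr⟩
  let P : Y → ℂ × EuclideanSpace ℂ (Fin N) := fun y => (0, φ.symm (ey y - ey (h x)))
  have hP0 : P (h x) = (0, 0) := by simp [P]
  have hP : ContMDiffAt 𝓘(ℂ, E₂) 𝓘(ℂ, ℂ × EuclideanSpace ℂ (Fin N)) ω P (h x) := by
    refine contMDiffAt_const.prodMk_space ?_
    have h1 : ContDiff ℂ ω fun e : E₂ => φ.symm (e - ey (h x)) :=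
      φ.symm.contDiff.comp (contDiff_id.sub contDiff_const)
    exact h1.contMDiff.contMDiffAt.comp (h x) contMDiffAt_extChartAt
  have hgat : ContMDiffAt 𝓘(ℂ, ℂ × EuclideanSpace ℂ (Fin N)) 𝓘(ℂ, E) ω g (P (h x)) := by
    rw [hP0]
    exact hg.contMDiffAt (S.2.mem_nhds hS0)
  have hτ : ContMDiffAt 𝓘(ℂ, E₂) 𝓘(ℂ, E) ω (fun y => g (P y)) (h x) := hgat.comp (h x) hP
  have hτ0 : g (P (h x)) = x := by
    rw [hP0]
    exact (hgA ⟨_, hS0⟩ rfl).trans hγ0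
  have hhτ : (fun y => h (g (P y))) =ᶠ[𝓝 (h x)] id := by
    have h1 : ∀ᶠ y in 𝓝 (h x), P y ∈ S := hP.continuousAt (by
      rw [hP0]
      exact S.2.mem_nhds hS0)
    have h2 : ∀ᶠ y in 𝓝 (h x), y ∈ ey.source := extChartAt_source_mem_nhds (h x)
    filter_upwards [h1, h2] with y hy1 hy2
    rw [hgh _ hy1]
    have h3 := hγc (P y).2 (Metric.ball_subset_closedBall hy1.2)
    rw [h3]
    simp [c, P, ey.left_inv hy2]
  -- `y ↦ g (P y)` is a holomorphic local section of `h` through `x`, so its derivative is a right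
  -- inverse of that of `h`.
  have hcomp : HasMFDerivAt 𝓘(ℂ, E₂) 𝓘(ℂ, E₂) (fun y => h (g (P y))) (h x)
      ((mfderiv 𝓘(ℂ, E) 𝓘(ℂ, E₂) h x).comp
        (mfderiv 𝓘(ℂ, E₂) 𝓘(ℂ, E) (fun y => g (P y)) (h x))) := by
    have h1 : HasMFDerivAt 𝓘(ℂ, E) 𝓘(ℂ, E₂) h (g (P (h x))) (mfderiv 𝓘(ℂ, E) 𝓘(ℂ, E₂) h x) := by
      rw [hτ0]
      exact ((hhol x).mdifferentiableAt (by simp)).hasMFDerivAt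
    exact h1.comp (h x) (hτ.mdifferentiableAt (by simp)).hasMFDerivAt
  have hid := hasMFDerivAt_unique hcomp ((hasMFDerivAt_id (h x)).congr_of_eventuallyEq hhτ)
  intro v
  exact ⟨_, congrArg (fun T : TangentSpace 𝓘(ℂ, E₂) (h x) →L[ℂ] TangentSpace 𝓘(ℂ, E₂) (h x) => T v)
    hid⟩

/-- The local spray approximation property ascends along Oka maps. -/
theorem IsOkaMap.lsapAt [IsManifold 𝓘(ℂ, E) ω X] [T2Space Y] [SecondCountableTopology Y] {h : X → Y}
    (hh : IsOkaMap E E₂ h) {x : X} (hx : LSAPAt E₂ (h x)) : LSAPAt E x := by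
  obtain ⟨Ψ, hΨ, -, hΨ1, hΨ2⟩ := (hh.1 x).exists_fibre_projection (hh.surjective_mfderiv x)
  obtain ⟨hhol, hserre, hoka⟩ := hh
  have e1 : ∀ᶠ q in 𝓝 (h x, x), ContMDiffAt (𝓘(ℂ, E₂).prod 𝓘(ℂ, E)) 𝓘(ℂ, E) ω Ψ q :=
    (contMDiffAt_iff_contMDiffAt_nhds (by simp)).mp hΨ
  obtain ⟨T, hT, hTo, hxT⟩ := eventually_nhds_iff.mp (e1.and hΨ1)
  obtain ⟨V, hV, H⟩ := hx
  have hgraph : Continuous fun x' => (h x', x') := hhol.continuous.prodMk continuous_id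
  have e2 : ∀ᶠ x' in 𝓝 x, (h x', x') ∈ T := hgraph.continuousAt (hTo.mem_nhds hxT)
  have e3 : ∀ᶠ x' in 𝓝 x, h x' ∈ V := hhol.continuous.continuousAt hV
  refine ⟨_, e2.and (hΨ2.and e3), ?_⟩
  rintro D D' hDD N F ⟨O₁, hO₁, hDO₁, hF, hFV⟩
  obtain ⟨r, hr0, hr1, hr⟩ := H D D' hDD N (fun q => h (F q))
    ⟨O₁, hO₁, hDO₁, hhol.comp_contMDiffOn hF, fun q hq => (hFV hq).2.2⟩
  -- The radius shrinks because the lifting is made holomorphic only over the open ball of radius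
  -- `r`.
  refine ⟨r / 2, by linarith, by linarith, fun d hd ε hε => ?_⟩
  obtain ⟨dY, hdY⟩ := exists_isCompatibleMetric E₂ Y
  have hDc : IsCompact D := hDD.1.isCompact
  have hBc : IsCompact (Metric.closedBall (0 : EuclideanSpace ℂ (Fin N)) r) :=
    isCompact_closedBall 0 r
  have hsub : D ×ˢ Metric.closedBall (0 : EuclideanSpace ℂ (Fin N)) r ⊆ O₁ ×ˢ Metric.ball 0 1 :=
    prod_mono hDO₁ (Metric.closedBall_subset_ball hr1)
  have hK : IsCompact (F '' (D ×ˢ Metric.closedBall (0 : EuclideanSpace ℂ (Fin N)) r)) :=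
    (hDc.prod hBc).image_of_continuousOn (hF.continuousOn.mono hsub)
  -- If `G` is `δ`-close to `h ∘ F`, then `Ψ (G, F)` is defined, lies over `G` and is within `ε / 2`
  -- of `F`, since `Ψ (h (F q), F q) = F q`. The other `ε / 2` is spent on the Oka property.
  obtain ⟨δ, hδ, Hδ⟩ := hK.exists_forall_dist_lt_mem dY hdY (h := h)
    hhol.continuous.continuousOn (W := T ∩ {p | d.dist p.2 (Ψ p) < ε / 2}) (by
      rintro _ ⟨q, hq, rfl⟩
      obtain ⟨h1, h2, -⟩ := hFV (hsub hq)
      refine Filter.inter_mem (hTo.mem_nhds h1) ?_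
      have hcont : ContinuousAt (fun p : Y × X => d.dist p.2 (Ψ p)) (h (F q), F q) :=
        hd.continuous_dist continuousAt_snd (hT _ h1).1.continuousAt
      have hself : d.dist (F q) (F q) = 0 := d.dist_self _
      refine hcont (Iio_mem_nhds ?_)
      change d.dist (F q) (Ψ (h (F q), F q)) < ε / 2
      rw [h2, hself]
      exact half_pos hε)
  obtain ⟨G, ⟨Ω, hΩ, hDΩ, hG⟩, hGd⟩ := hr dY hdY δ hδ
  have hGF : ContMDiffOn 𝓘(ℂ, ℂ × EuclideanSpace ℂ (Fin N)) (𝓘(ℂ, E₂).prod 𝓘(ℂ, E)) ω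
      (fun q => (G q, F q)) (Ω ∩ O₁ ×ˢ Metric.ball 0 1) :=
    (hG.mono inter_subset_left).prodMk (hF.mono inter_subset_right)
  have hQo : IsOpen ((Ω ∩ O₁ ×ˢ Metric.ball 0 1) ∩ (fun q => (G q, F q)) ⁻¹' T) :=
    hGF.continuousOn.isOpen_inter_preimage (hΩ.inter (hO₁.prod Metric.isOpen_ball)) hTo
  have hDQ : D ×ˢ Metric.closedBall (0 : EuclideanSpace ℂ (Fin N)) r ⊆
      (Ω ∩ O₁ ×ˢ Metric.ball 0 1) ∩ (fun q => (G q, F q)) ⁻¹' T := fun q hq =>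
    ⟨⟨hDΩ (prod_mono hDD.2.2.1 le_rfl hq), hsub hq⟩,
      (Hδ _ (mem_image_of_mem F hq) (G q) (hGd q hq)).1⟩
  obtain ⟨U, B, hU, -, hDU, hrB, hUB⟩ := generalized_tube_lemma hDc hBc hQo hDQ
  obtain ⟨W, B', hW, -, hDW, hrB', hWB'⟩ := generalized_tube_lemma hDD.2.1.isCompact hBc hΩ hDΩ
  have hUQ := (prod_mono (le_refl U) hrB).trans hUB
  have hWΩ := (prod_mono (le_refl W) hrB').trans hWB'
  have hF' : ContMDiffOn 𝓘(ℂ, ℂ × EuclideanSpace ℂ (Fin N)) 𝓘(ℂ, E) ω (fun q => Ψ (G q, F q))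
      ((Ω ∩ O₁ ×ˢ Metric.ball 0 1) ∩ (fun q => (G q, F q)) ⁻¹' T) := fun q hq =>
    (hT _ hq.2).1.comp_contMDiffWithinAt q ((hGF q hq.1).mono inter_subset_left)
  obtain ⟨O, O₀, f, hO, hDO, hOW, hO₀, hDO₀, hO₀O, hO₀U, hf, hfG, hfF⟩ :=
    hserre.exists_extension hDD hr0 hU hDU hW hDW (hG.continuousOn.mono hWΩ)
      (hF'.continuousOn.mono hUQ) (fun q hq => (hT _ (hUQ hq).2).2)
  let S : TopologicalSpace.Opens (ℂ × EuclideanSpace ℂ (Fin N)) :=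
    ⟨O ×ˢ Metric.ball 0 r, hO.prod Metric.isOpen_ball⟩
  have hball : Metric.closedBall (0 : EuclideanSpace ℂ (Fin N)) (r / 2) ⊆ Metric.ball 0 r :=
    Metric.closedBall_subset_ball (by linarith)
  have hSΩ : (S : Set (ℂ × EuclideanSpace ℂ (Fin N))) ⊆ Ω :=
    (prod_mono hOW Metric.ball_subset_closedBall).trans hWΩ
  obtain ⟨g, hg, -, -, hgd⟩ := hoka.exists_lift (S := S) (D := D) (r := r / 2) (A := ∅) hO rfl hDc
    (prod_mono (hDO₀.trans hO₀O) hball) (fun c hc => hDD.1.exists_polynomial hc)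
    ⟨isClosed_empty, fun s hs => absurd hs (notMem_empty s)⟩ hf.continuousOn
    ((hG.mono hSΩ).congr hfG) (hO₀.prod Metric.isOpen_ball)
    (prod_mono hDO₀ hball)
    ((hF'.mono ((prod_mono hO₀U Metric.ball_subset_closedBall).trans hUQ)).congr hfF)
    (fun s hs => absurd hs (notMem_empty s)) d hd (half_pos hε)
  refine ⟨g, ⟨S, S.2, prod_mono hDO hball, hg⟩, fun q hq => ?_⟩
  have h1 := hgd q hq
  have hq' : q ∈ D ×ˢ Metric.closedBall (0 : EuclideanSpace ℂ (Fin N)) r :=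
    prod_mono le_rfl (Metric.closedBall_subset_closedBall (by linarith)) hq
  have h2 : d.dist (F q) (Ψ (G q, F q)) < ε / 2 :=
    (Hδ _ (mem_image_of_mem F hq') (G q) (hGd q hq')).2
  rw [hfF q (prod_mono hDO₀ hball hq)] at h1
  have h3 : d.dist (F q) (g q) ≤ d.dist (F q) (Ψ (G q, F q)) + d.dist (Ψ (G q, F q)) (g q) :=
    d.dist_triangle _ _ _
  linarith

end Oka
-- The proposition
theorem mainTheorem11
    {E : Type u₁} [NormedAddCommGroup E] [NormedSpace ℂ E] [FiniteDimensional ℂ E]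
    {X : Type v₁} [TopologicalSpace X] [T2Space X] [SecondCountableTopology X]
    [ChartedSpace E X] [IsManifold 𝓘(ℂ, E) ω X]
    {E₂ : Type u₂} [NormedAddCommGroup E₂] [NormedSpace ℂ E₂] [FiniteDimensional ℂ E₂]
    {Y : Type v₂} [TopologicalSpace Y] [T2Space Y] [SecondCountableTopology Y]
    [ChartedSpace E₂ Y] [IsManifold 𝓘(ℂ, E₂) ω Y]
    {E₃ : Type u₃} [NormedAddCommGroup E₃] [NormedSpace ℂ E₃] [FiniteDimensional ℂ E₃]
    {Z : Type v₃} [TopologicalSpace Z] [T2Space Z] [SecondCountableTopology Z]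
    [ChartedSpace E₃ Z] [IsManifold 𝓘(ℂ, E₃) ω Z] :
    (StronglyDominableByLSAP.{u₁, v₁, w, w'} E X → LSAP E X) ∧
    (∀ g : Z → X, ContMDiff 𝓘(ℂ, E₃) 𝓘(ℂ, E) ω g → Function.Surjective g →
      (∀ z, Function.Surjective (mfderiv 𝓘(ℂ, E₃) 𝓘(ℂ, E) g z)) →
      LSAP E₃ Z → LSAP E X) ∧
    (∀ h : X → Y, IsOkaMap E E₂ h → Function.Surjective h → LSAP E₂ Y → LSAP E X) ∧
    (∀ 𝒰 : Set (TopologicalSpace.Opens X), (∀ x : X, ∃ U ∈ 𝒰, x ∈ U) →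
      (∀ U ∈ 𝒰, LSAP E U) → LSAP E X) := by
  refine ⟨fun hX x => ?_, fun g hg hgs hgd hZ x => ?_, fun h hh _ hY x => hh.lsapAt (hY (h x)),
    fun 𝒰 h𝒰 hU x => ?_⟩
  · obtain ⟨M, _, _, _, Y, _, _, _, _, _, h, y, hY, hh, rfl, hs⟩ := hX x
    exact (hY y).of_submersion hh hs
  · obtain ⟨z, rfl⟩ := hgs x
    exact (hZ z).of_submersion hg (hgd z)
  · obtain ⟨U, hU𝒰, hxU⟩ := h𝒰 x
    exact (hU U hU𝒰 ⟨x, hxU⟩).of_opens
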